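/- Let $n\ge 0$ and let $\mathbb H$ be the real quaternions. Equip the right $\mathbb H$-vector space $V=\mathbb H^{n+1}$ with the Hermitian form $\Phi(z,w)=-\bar z_0w_0+\bar z_1w_1+\dots+\bar z_nw_n$, put $J=\mathrm{diag}(-1,1,\dots,1)$ and let $\mathrm{Sp}(n,1)=\{g\in \mathrm{GL}(n+1,\mathbb H) : {}^t\bar g Jg=J\}$, which acts on the projective space $\mathbb P(V)$ of right $\mathbb H$-lines. Let $\mathbf H^n_{\mathbb H}\subset\mathbb P(V)$ be the set of lines spanned by vectors $v$ with $\Phi(v,v)<0$, and $\partial\mathbf H^n_{\mathbb H}$ the set of lines spanned by vectors $v\ne0$ with $\Phi(v,v)=0$. An element $g\in\mathrm{Sp}(n,1)$ is *elliptic* if it has a fixed point in $\mathbf H^n_{\mathbb H}$, *parabolic* if it has exactly one fixed point on $\partial\mathbf H^n_{\mathbb H}$, and *hyperbolic* if it has exactly two fixed points on $\partial\mathbf H^n_{\mathbb H}$. It is *unipotent* if $g-1$ is nilpotent. Minimal polynomials are taken over $\mathbb R$. A *vertical* (resp. *non-vertical*) *translation* is a unipotent parabolic element with minimal polynomial $(x-1)^2$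 (resp. $(x-1)^3$). An element $g$ is *strongly reversible* if $g^{-1}=xgx^{-1}$ for some $x\in\mathrm{Sp}(n,1)$ with $x^2=1$. An eigenvalue of $g$ is a quaternion $\lambda$ with $gv=v\lambda$ for some $v\neq0$; eigenvalues occur in similarity classes $[\lambda]=\{\mu^{-1}\lambda\mu : \mu\in\mathbb H^\times\}$. The eigenspace $V_\lambda$ is the right $\mathbb H$-span of $\{v: gv=v\lambda\}$ (it depends only on $[\lambda]$), and the multiplicity of $[\lambda]$ is $\dim_{\mathbb H}V_\lambda$. The eigenvalue $\lambda$ is of *positive* (resp. *negative*) *type* if $\Phi(v,v)>0$ (resp. $<0$) for every $v\ne0$ with $gv=v\lambda$; it is *null* if $\Phi|_{V_\lambda}$ is degenerate; it is of *indefinite type* if $V_\lambda$ contains vectors $v,w$ with $\Phi(v,v)>0>\Phi(w,w)$. Say that $g$ satisfies condition $(P)$ if every eigenvalue class of positive type of $g$ is $\{1\}$, or $\{-1\}$, or has even multiplicity. Theorem. Let $g\in\mathrm{Sp}(n,1)$. 1. If $g$ is hyperbolic, then $g$ is strongly reversible if and only if $(P)$ holds and the null eigenvalues of $g$ are real numbers.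 2. If $g$ is elliptic, then $g$ is strongly reversible if and only if the eigenvalue of negative or indefinite type of $g$ is $1$ or $-1$ (that is, the set of eigenvalues of negative or indefinite type is $\{1\}$ or $\{-1\}$) and $(P)$ holds. 3. If $g$ is a vertical translation, then $g$ is not strongly reversible. 4. If $g$ is a non-vertical translation, then $g$ is strongly reversible. 5. If $g$ is parabolic and not unipotent, then $g$ has a Jordan decomposition $g=g_sg_u=g_ug_s$ with $g_s,g_u\in\mathrm{Sp}(n,1)$, $g_s$ elliptic and $g_u$ unipotent; and for any such decomposition, $g$ is strongly reversible if and only if the null eigenvalue of $g$ is $1$ or $-1$ (that is, the set of null eigenvalues is $\{1\}$ or $\{-1\}$), the minimal polynomial of $g_u$ is $(x-1)^3$, and $(P)$ holds. -/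

import Mathlib

open scoped Quaternion Matrix

noncomputable section

namespace QuatHyp

/-- `ℍ^{n,1} = ℍ^{n+1}`, seen as a right vector space over `ℍ`, i.e. as an `ℍᵐᵒᵖ`-module:
`MulOpposite.op μ • v` is `v μ`. -/
abbrev V (n : ℕ) : Type := Fin (n + 1) → ℍ[ℝ]

/-- Square quaternionic matrices of size `n + 1`. -/
abbrev Mat (n : ℕ) : Type := Matrix (Fin (n + 1)) (Fin (n + 1)) ℍ[ℝ]

/-- The Hermitian form `Φ(z, w) = - z̄₀ w₀ + z̄₁ w₁ + ⋯ + z̄ₙ wₙ`. -/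
def Phi {n : ℕ} (z w : V n) : ℍ[ℝ] :=
  -(star (z 0) * w 0) + ∑ i : Fin n, star (z i.succ) * w i.succ

/-- `J = diag(-1, 1, …, 1)`. -/
def J (n : ℕ) : Mat n := Matrix.diagonal (Fin.cons (-1) fun _ => 1)

/-- The group `Sp(n,1)` of all `g ∈ GL(n+1, ℍ)` with `ᵗḡ J g = J`. -/
def Sp (n : ℕ) : Subgroup (Mat n)ˣ where
  carrier := {g | (g : Mat n)ᴴ * J n * (g : Mat n) = J n}
  one_mem' := by simp
  mul_mem' := by
    intro a b ha hb
    simp only [Set.mem_ofPred_eq, Units.val_mul, Matrix.conjTranspose_mul] at *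
    calc (b : Mat n)ᴴ * (a : Mat n)ᴴ * J n * ((a : Mat n) * (b : Mat n))
        = (b : Mat n)ᴴ * ((a : Mat n)ᴴ * J n * (a : Mat n)) * (b : Mat n) := by
          simp only [mul_assoc]
      _ = J n := by rw [ha, hb]
  inv_mem' := by
    intro a ha
    simp only [Set.mem_ofPred_eq] at *
    have h1 : (a : Mat n) * ((a⁻¹ : (Mat n)ˣ) : Mat n) = 1 := a.mul_inv
    have h2 : ((a⁻¹ : (Mat n)ˣ) : Mat n)ᴴ * (a : Mat n)ᴴ = 1 := by
      rw [← Matrix.conjTranspose_mul, h1, Matrix.conjTranspose_one]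
    calc ((a⁻¹ : (Mat n)ˣ) : Mat n)ᴴ * J n * ((a⁻¹ : (Mat n)ˣ) : Mat n)
        = ((a⁻¹ : (Mat n)ˣ) : Mat n)ᴴ * ((a : Mat n)ᴴ * J n * (a : Mat n)) *
            ((a⁻¹ : (Mat n)ˣ) : Mat n) := by rw [ha]
      _ = (((a⁻¹ : (Mat n)ˣ) : Mat n)ᴴ * (a : Mat n)ᴴ) * J n *
            ((a : Mat n) * ((a⁻¹ : (Mat n)ˣ) : Mat n)) := by simp only [mul_assoc]
      _ = J n := by rw [h1, h2, one_mul, mul_one]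

/-- The underlying matrix of an element of `Sp(n,1)`. -/
def mat {n : ℕ} (g : Sp n) : Mat n := ((g : (Mat n)ˣ) : Mat n)

/-- An element `g` of a group `G` is strongly reversible if `g⁻¹ = x g x⁻¹` for some `x ∈ G`
with `x² = 1`. -/
def StronglyReversible {G : Type*} [Group G] (g : G) : Prop :=
  ∃ x : G, x ^ 2 = 1 ∧ g⁻¹ = x * g * x⁻¹

/-- The right-linear map `v ↦ g v`. -/
def toLin {n : ℕ} (g : Sp n) : V n →ₗ[ℍ[ℝ]ᵐᵒᵖ] V n where
  toFun v := mat g *ᵥ v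
  map_add' v w := Matrix.mulVec_add _ v w
  map_smul' c v := Matrix.mulVec_smul _ c v

theorem toLin_injective {n : ℕ} (g : Sp n) : Function.Injective (toLin g) := by
  intro v w h
  have h' : mat g *ᵥ v = mat g *ᵥ w := h
  have hg : mat g⁻¹ * mat g = 1 := (g : (Mat n)ˣ).inv_mul
  have := congrArg (fun u => mat g⁻¹ *ᵥ u) h'
  simpa [Matrix.mulVec_mulVec, hg] using this

/-! ### The quaternionic hyperbolic space, its boundary, and the types of isometries -/

/-- The quaternionic projective space `ℙ(V)`: nonzero vectors modulo `v ∼ v μ`. -/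
abbrev PV (n : ℕ) : Type := Projectivization ℍ[ℝ]ᵐᵒᵖ (V n)

/-- The action of `Sp(n,1)` on the projective space. -/
def act {n : ℕ} (g : Sp n) : PV n → PV n :=
  Projectivization.map (toLin g) (toLin_injective g)

/-- The quaternionic hyperbolic space: the set of lines spanned by negative vectors. -/
def hyperbolicSpace (n : ℕ) : Set (PV n) :=
  {p | ∃ (v : V n) (hv : v ≠ 0), (Phi v v).re < 0 ∧ Projectivization.mk _ v hv = p}

/-- Its boundary: the set of lines spanned by nonzero null vectors. -/
def boundary (n : ℕ) : Set (PV n) :=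
  {p | ∃ (v : V n) (hv : v ≠ 0), Phi v v = 0 ∧ Projectivization.mk _ v hv = p}

/-- `g` has a fixed point in the hyperbolic space. -/
def IsElliptic {n : ℕ} (g : Sp n) : Prop :=
  ∃ p ∈ hyperbolicSpace n, act g p = p

/-- `g` has exactly one fixed point on the boundary. -/
def IsParabolic {n : ℕ} (g : Sp n) : Prop :=
  {p ∈ boundary n | act g p = p}.encard = 1

/-- `g` has exactly two fixed points on the boundary. -/
def IsHyperbolic {n : ℕ} (g : Sp n) : Prop :=
  {p ∈ boundary n | act g p = p}.encard = 2

/-- `g` is unipotent: `g - 1` is nilpotent. -/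
def IsUnipotent {n : ℕ} (g : Sp n) : Prop := IsNilpotent (mat g - 1)

/-- The minimal polynomial of `g` (over `ℝ`, the centre of `ℍ`). -/
def minimalPolynomial {n : ℕ} (g : Sp n) : Polynomial ℝ := minpoly ℝ (mat g)

/-- A unipotent parabolic element with minimal polynomial `(x - 1)²`. -/
def IsVerticalTranslation {n : ℕ} (g : Sp n) : Prop :=
  IsParabolic g ∧ IsUnipotent g ∧ minimalPolynomial g = (Polynomial.X - 1) ^ 2

/-- A unipotent parabolic element with minimal polynomial `(x - 1)³`. -/
def IsNonVerticalTranslation {n : ℕ} (g : Sp n) : Prop :=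
  IsParabolic g ∧ IsUnipotent g ∧ minimalPolynomial g = (Polynomial.X - 1) ^ 3

/-- `g = s u` is the Jordan decomposition of `g` in `Sp(n,1)`: `s` and `u` commute, `s` is elliptic
(hence semisimple), and `u` is unipotent. -/
def IsJordanDecomposition {n : ℕ} (g s u : Sp n) : Prop :=
  g = s * u ∧ Commute s u ∧ IsElliptic s ∧ IsUnipotent u

/-! ### Eigenvalues -/

/-- `v` is an eigenvector of `g` with (right) eigenvalue `lam`: `v ≠ 0` and `g v = v lam`. -/
def IsEigenvector {n : ℕ} (g : Sp n) (lam : ℍ[ℝ]) (v : V n) : Prop :=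
  v ≠ 0 ∧ mat g *ᵥ v = MulOpposite.op lam • v

/-- `lam` is a (right) eigenvalue of `g`. -/
def IsEigenvalue {n : ℕ} (g : Sp n) (lam : ℍ[ℝ]) : Prop := ∃ v, IsEigenvector g lam v

/-- The eigenspace of `lam`: the right `ℍ`-subspace spanned by the solutions of `g v = v lam`.
If `g v = v lam` then `g (v μ) = (v μ) (μ⁻¹ lam μ)`, so that it depends only on the similarity
class `[lam]`. -/
def eigenspace {n : ℕ} (g : Sp n) (lam : ℍ[ℝ]) : Submodule ℍ[ℝ]ᵐᵒᵖ (V n) :=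
  Submodule.span ℍ[ℝ]ᵐᵒᵖ {v | mat g *ᵥ v = MulOpposite.op lam • v}

/-- The multiplicity of the eigenvalue class `[lam]`: the quaternionic dimension of its
eigenspace. -/
def multiplicity {n : ℕ} (g : Sp n) (lam : ℍ[ℝ]) : ℕ :=
  Module.finrank ℍ[ℝ]ᵐᵒᵖ (eigenspace g lam)

/-- Eigenvalues of positive type: every eigenvector is a positive vector. -/
def IsPositiveType {n : ℕ} (g : Sp n) (lam : ℍ[ℝ]) : Prop :=
  IsEigenvalue g lam ∧ ∀ v, IsEigenvector g lam v → 0 < (Phi v v).re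

/-- Eigenvalues of negative type: every eigenvector is a negative vector. -/
def IsNegativeType {n : ℕ} (g : Sp n) (lam : ℍ[ℝ]) : Prop :=
  IsEigenvalue g lam ∧ ∀ v, IsEigenvector g lam v → (Phi v v).re < 0

/-- Null eigenvalues: the form restricted to the eigenspace is degenerate. -/
def IsNullEigenvalue {n : ℕ} (g : Sp n) (lam : ℍ[ℝ]) : Prop :=
  ∃ v ∈ eigenspace g lam, v ≠ 0 ∧ ∀ w ∈ eigenspace g lam, Phi v w = 0

/-- Eigenvalues of indefinite type: the eigenspace contains positive and negative vectors. -/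
def IsIndefiniteType {n : ℕ} (g : Sp n) (lam : ℍ[ℝ]) : Prop :=
  (∃ v ∈ eigenspace g lam, 0 < (Phi v v).re) ∧ ∃ w ∈ eigenspace g lam, (Phi w w).re < 0

/-- Every positive eigenvalue class of `g` is `1`, or `-1`, or of even multiplicity. -/
def PositiveClassCondition {n : ℕ} (g : Sp n) : Prop :=
  ∀ lam, IsPositiveType g lam → lam = 1 ∨ lam = -1 ∨ Even (multiplicity g lam)

end QuatHyp

end

open scoped Quaternion Matrix RightActions

namespace QuatHyp

/-! Strong reversibility of `g` means that some `x` satisfies `x² = 1` and `(xg)² = 1` (`Reverses`).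
Such an `x` is self-adjoint for the form and sends an eigenvector for `l` to one for `l⁻¹`.

Necessity. If `|l| = 1` and `l ≠ ±1`, an eigenvector `e` is orthogonal to `x e`
(`Reverses.Phi_orthogonal`). A suitable multiple of `x e` is then a second eigenvector for `l`, so
positive nonreal classes split into pairs (`Reverses.even_finrank`); a negative `e` cannot be
orthogonal to `x e`, which settles the elliptic case. On the boundary `x` permutes the fixed points
of `g`: a point fixed by `x` has eigenvalue `±1`, and two points exchanged by `x` have real
eigenvalues. For parabolic `g`, if `(g_u - 1)² = 0` then `g` would translate a negative vector along
the fixed line, which no `x` can reverse (`Reverses.not_translation`).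

Sufficiency. An involution is written down on a small core: a negative line, a hyperbolic plane, or
a three-dimensional Jordan chain. The complement is invariant and positive definite, hence spanned
by eigenvectors; the real ones are left alone and the nonreal ones are exchanged in pairs by
reflections (`exists_reverses`).

Two devices recur. Since `{v | g v = v l}` is not a right subspace, classes are handled through the
kernel `quadSpace` of a real quadratic polynomial. The Jordan decomposition comes from the real
Jordan–Chevalley theorem: its components are real polynomials in `g`, and taking adjoints replaces
`g` by `g⁻¹`, which puts them in the group. -/

variable {n : ℕ}

/-! ### The Hermitian form -/

theorem Phi_add_right (u v w : V n) : Phi u (v + w) = Phi u v + Phi u w := by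
  simp only [Phi, Pi.add_apply, mul_add, Finset.sum_add_distrib]; abel

theorem Phi_add_left (u v w : V n) : Phi (u + v) w = Phi u w + Phi v w := by
  simp only [Phi, Pi.add_apply, star_add, add_mul, Finset.sum_add_distrib]; abel

theorem star_Phi (v w : V n) : star (Phi v w) = Phi w v := by
  simp [Phi, star_sum]

theorem Phi_smul_right (v w : V n) (c : ℍ[ℝ]) : Phi v (w <• c) = Phi v w * c := by
  simp [Phi, add_mul, Finset.sum_mul, mul_assoc]

theorem Phi_smul_left (v w : V n) (c : ℍ[ℝ]) : Phi (v <• c) w = star c * Phi v w := by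
  rw [← star_Phi, Phi_smul_right, star_mul, star_Phi]

theorem Phi_zero_right (v : V n) : Phi v 0 = 0 := by simp [Phi]

theorem Phi_zero_left (v : V n) : Phi 0 v = 0 := by simp [Phi]

theorem Phi_neg_right (v w : V n) : Phi v (-w) = -Phi v w := by
  have := Phi_add_right v w (-w)
  rw [add_neg_cancel, Phi_zero_right] at this
  exact (neg_eq_of_add_eq_zero_right this.symm).symm

theorem Phi_neg_left (v w : V n) : Phi (-v) w = -Phi v w := by
  rw [← star_Phi, Phi_neg_right, star_neg, star_Phi]

theorem Phi_sub_right (u v w : V n) : Phi u (v - w) = Phi u v - Phi u w := by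
  rw [sub_eq_add_neg, Phi_add_right, Phi_neg_right, sub_eq_add_neg]

theorem Phi_sub_left (u v w : V n) : Phi (u - v) w = Phi u w - Phi v w := by
  rw [sub_eq_add_neg, Phi_add_left, Phi_neg_left, sub_eq_add_neg]

theorem smul_coe (r : ℝ) (v : V n) : v <• (r : ℍ[ℝ]) = r • v := by
  ext1 i
  simp only [Pi.smul_apply, MulOpposite.smul_eq_mul_unop, MulOpposite.unop_op,
    Quaternion.mul_coe_eq_smul]

theorem Phi_real_smul_right (r : ℝ) (v w : V n) : Phi v (r • w) = r • Phi v w := by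
  rw [← smul_coe, Phi_smul_right, Quaternion.mul_coe_eq_smul]

theorem Phi_real_smul_left (r : ℝ) (v w : V n) : Phi (r • v) w = r • Phi v w := by
  rw [← smul_coe, Phi_smul_left, Quaternion.star_coe, Quaternion.coe_mul_eq_smul]

theorem Phi_self (v : V n) : Phi v v = ((Phi v v).re : ℍ[ℝ]) :=
  Quaternion.star_eq_self.mp (star_Phi v v)

theorem Phi_comm_eq_zero {v w : V n} (h : Phi v w = 0) : Phi w v = 0 := by
  rw [← star_Phi, h, star_zero]

theorem Phi_comm_ne_zero {v w : V n} (h : Phi v w ≠ 0) : Phi w v ≠ 0 :=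
  fun h' => h (Phi_comm_eq_zero h')

theorem Phi_self_eq_zero {v : V n} (h : (Phi v v).re = 0) : Phi v v = 0 := by
  rw [Phi_self, h, Quaternion.coe_zero]

theorem re_star_mul_self (a : ℍ[ℝ]) : (star a * a).re = ‖a‖ ^ 2 := by
  rw [Quaternion.star_mul_self, Quaternion.re_coe, Quaternion.normSq_eq_norm_mul_self, sq]

theorem re_sum {ι : Type*} (s : Finset ι) (f : ι → ℍ[ℝ]) :
    (∑ i ∈ s, f i).re = ∑ i ∈ s, (f i).re :=
  map_sum (AddMonoidHom.mk' (fun a : ℍ[ℝ] => a.re) fun a b => Quaternion.re_add a b) f s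

theorem re_Phi_self (v : V n) :
    (Phi v v).re = -‖v 0‖ ^ 2 + ∑ i : Fin n, ‖v i.succ‖ ^ 2 := by
  simp only [Phi, Quaternion.re_add, Quaternion.re_neg, re_star_mul_self, re_sum]

/-! ### Signature -/

theorem Phi_eq_zero_iff_coord {v w : V n} (h : Phi v w = 0) :
    star (v 0) * w 0 = ∑ i : Fin n, star (v i.succ) * w i.succ := by
  unfold Phi at h
  exact (neg_add_eq_zero.mp h)

/-- The orthogonal complement of a negative vector is positive definite. -/
theorem pos_of_orthogonal_neg {v w : V n} (hv : (Phi v v).re < 0) (h : Phi v w = 0)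
    (hw : w ≠ 0) : 0 < (Phi w w).re := by
  have hc := Phi_eq_zero_iff_coord h
  rw [re_Phi_self] at hv ⊢
  set A := ∑ i : Fin n, ‖v i.succ‖ ^ 2 with hA
  set B := ∑ i : Fin n, ‖w i.succ‖ ^ 2 with hB
  have hA0 : 0 ≤ A := by positivity
  have hB0 : 0 ≤ B := by positivity
  -- Reversed Cauchy–Schwarz: orthogonality equates the zeroth term with the sum of the others,
  -- giving `‖v 0‖² ‖w 0‖² ≤ A B`, whereas `A < ‖v 0‖²` and, if the claim failed, `B ≤ ‖w 0‖²`.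
  have h1 : ‖v 0‖ * ‖w 0‖ ≤ ∑ i : Fin n, ‖v i.succ‖ * ‖w i.succ‖ := by
    calc ‖v 0‖ * ‖w 0‖ = ‖star (v 0) * w 0‖ := by rw [norm_mul, norm_star]
      _ = ‖∑ i : Fin n, star (v i.succ) * w i.succ‖ := by rw [hc]
      _ ≤ ∑ i : Fin n, ‖star (v i.succ) * w i.succ‖ := norm_sum_le _ _
      _ = _ := by simp only [norm_mul, norm_star]
  have h2 : (‖v 0‖ * ‖w 0‖) ^ 2 ≤ A * B :=
    (pow_le_pow_left₀ (by positivity) h1 2).trans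
      (Finset.sum_mul_sq_le_sq_mul_sq _ _ _)
  -- `B > 0` makes the final inequality strict; `B = 0` would force `w = 0` because `v 0 ≠ 0`.
  have hBpos : 0 < B := by
    rcases hB0.lt_or_eq with h | h
    · exact h
    · exfalso
      apply hw
      rw [← h, mul_zero] at h2
      have hv0 : ‖v 0‖ ≠ 0 := fun h0 => by rw [h0] at hv; simp at hv; linarith
      have hw0 : ‖w 0‖ = 0 := by
        have : ‖v 0‖ * ‖w 0‖ = 0 := pow_eq_zero_iff two_ne_zero |>.mp (le_antisymm h2 (by positivity))
        exact (mul_eq_zero.mp this).resolve_left hv0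
      ext1 i
      refine Fin.cases (by simpa using hw0) (fun i => ?_) i
      have := (Finset.sum_eq_zero_iff_of_nonneg (fun i _ => by positivity)).mp h.symm i
        (Finset.mem_univ _)
      simpa using this
  by_contra hcon
  have h3 : B ≤ ‖w 0‖ ^ 2 := by linarith
  have h4 : A < ‖v 0‖ ^ 2 := by linarith
  have : A * B < ‖v 0‖ ^ 2 * ‖w 0‖ ^ 2 := by nlinarith
  rw [mul_pow] at h2
  linarith

/-- If `w` were negative, `p` would be positive as a nonzero vector of its orthogonal complement. -/
theorem nonneg_of_orthogonal_null {p w : V n} (hp : p ≠ 0) (hpp : Phi p p = 0)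
    (h : Phi p w = 0) : 0 ≤ (Phi w w).re := by
  by_contra hcon
  have := pos_of_orthogonal_neg (not_le.mp hcon) (Phi_comm_eq_zero h) hp
  rw [hpp] at this
  simp at this

/-- Two orthogonal null vectors are proportional. -/
theorem exists_eq_smul_of_null {p w : V n} (hp : p ≠ 0) (hpp : Phi p p = 0)
    (hww : Phi w w = 0) (h : Phi p w = 0) : ∃ c : ℍ[ℝ], w = p <• c := by
  have hp0 : p 0 ≠ 0 := by
    intro h0
    have h1 := re_Phi_self p
    rw [hpp, h0] at h1
    simp only [Quaternion.re_zero, norm_zero, ne_eq, OfNat.ofNat_ne_zero, not_false_eq_true,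
      zero_pow, neg_zero, zero_add] at h1
    apply hp
    ext1 i
    refine Fin.cases (by simpa using h0) (fun i => ?_) i
    have := (Finset.sum_eq_zero_iff_of_nonneg (fun i _ => by positivity)).mp h1.symm i
      (Finset.mem_univ _)
    simpa using this
  refine ⟨(p 0)⁻¹ * w 0, ?_⟩
  -- The multiple of `p` is chosen to cancel coordinate `0`; `u` is still null, and the form is
  -- positive definite on vectors with that coordinate zero.
  set u := w - p <• ((p 0)⁻¹ * w 0) with hu
  have hu0 : u 0 = 0 := by
    simp [hu, hp0]
  have huu : Phi u u = 0 := by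
    simp only [hu, Phi_sub_left, Phi_sub_right, Phi_smul_left, Phi_smul_right, hpp, hww, h,
      Phi_comm_eq_zero h, mul_zero, zero_mul, sub_zero]
  have h1 := re_Phi_self u
  rw [huu, hu0] at h1
  simp only [Quaternion.re_zero, norm_zero, ne_eq, OfNat.ofNat_ne_zero, not_false_eq_true,
    zero_pow, neg_zero, zero_add] at h1
  have hz : u = 0 := by
    ext1 i
    refine Fin.cases (by simpa using hu0) (fun i => ?_) i
    have := (Finset.sum_eq_zero_iff_of_nonneg (fun i _ => by positivity)).mp h1.symm i
      (Finset.mem_univ _)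
    simpa using this
  rw [hu] at hz
  exact sub_eq_zero.mp hz

/-- The form is nondegenerate. -/
theorem eq_zero_of_Phi_eq_zero {v : V n} (h : ∀ w, Phi v w = 0) : v = 0 := by
  ext1 i
  refine Fin.cases ?_ (fun i => ?_) i
  · have := h (Pi.single 0 1)
    simpa [Phi] using this
  · have := h (Pi.single i.succ 1)
    simpa [Phi, Pi.single_apply, Fin.succ_ne_zero, (Fin.succ_ne_zero _).symm] using this

theorem exists_Phi_ne_zero {v : V n} (h : v ≠ 0) : ∃ w, Phi v w ≠ 0 := by
  by_contra hcon
  push Not at hcon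
  exact h (eq_zero_of_Phi_eq_zero hcon)

/-! ### The action of `Sp(n,1)` on vectors -/

theorem toLin_mul (g h : Sp n) (v : V n) : toLin (g * h) v = toLin g (toLin h v) :=
  (Matrix.mulVec_mulVec v (mat g) (mat h)).symm

theorem toLin_one (v : V n) : toLin (1 : Sp n) v = v := Matrix.one_mulVec v

theorem toLin_inv_apply (g : Sp n) (v : V n) : toLin g⁻¹ (toLin g v) = v := by
  rw [← toLin_mul, inv_mul_cancel, toLin_one]

theorem toLin_apply_inv (g : Sp n) (v : V n) : toLin g (toLin g⁻¹ v) = v := by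
  rw [← toLin_mul, mul_inv_cancel, toLin_one]

theorem toLin_right (g : Sp n) (v : V n) (c : ℍ[ℝ]) : toLin g (v <• c) = toLin g v <• c :=
  (toLin g).map_smul _ v

theorem toLin_real (g : Sp n) (r : ℝ) (v : V n) : toLin g (r • v) = r • toLin g v := by
  rw [← smul_coe, toLin_right, smul_coe]

theorem toLin_eq_zero {g : Sp n} {v : V n} : toLin g v = 0 ↔ v = 0 :=
  map_eq_zero_iff _ (toLin_injective g)

theorem Phi_eq_dotProduct (v w : V n) : Phi v w = star v ⬝ᵥ (J n *ᵥ w) := by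
  simp [Phi, J, dotProduct, Matrix.mulVec_diagonal, Fin.sum_univ_succ]

theorem matrix_ext {A B : Mat n} (h : ∀ v w : V n, star v ⬝ᵥ (A *ᵥ w) = star v ⬝ᵥ (B *ᵥ w)) :
    A = B := by
  ext1 i j
  have := h (Pi.single i 1) (Pi.single j 1)
  simpa [← Pi.single_star] using this

theorem mulVec_ext {A B : Mat n} (h : ∀ w : V n, A *ᵥ w = B *ᵥ w) : A = B :=
  matrix_ext fun v w => by rw [h]

theorem Phi_mulVec (A : Mat n) (v w : V n) :
    Phi (A *ᵥ v) (A *ᵥ w) = star v ⬝ᵥ ((Aᴴ * J n * A) *ᵥ w) := by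
  rw [Phi_eq_dotProduct, Matrix.star_mulVec, ← Matrix.dotProduct_mulVec, Matrix.mulVec_mulVec,
    Matrix.mulVec_mulVec, mul_assoc]

theorem Phi_toLin (g : Sp n) (v w : V n) : Phi (toLin g v) (toLin g w) = Phi v w := by
  have h : (mat g)ᴴ * J n * mat g = J n := g.2
  calc _ = _ := Phi_mulVec (mat g) v w
    _ = _ := by rw [h, Phi_eq_dotProduct]

theorem Phi_toLin_left (g : Sp n) (v w : V n) : Phi (toLin g v) w = Phi v (toLin g⁻¹ w) := by
  rw [← Phi_toLin g v, toLin_apply_inv]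

theorem Phi_toLin_right (g : Sp n) (v w : V n) : Phi v (toLin g w) = Phi (toLin g⁻¹ v) w := by
  rw [← Phi_toLin g _ w, toLin_apply_inv]

theorem toLin_ext {g h : Sp n} (H : ∀ v, toLin g v = toLin h v) : g = h :=
  Subtype.ext (Units.ext (mulVec_ext H))

/-- An invertible matrix preserving the form defines an element of `Sp(n,1)`. -/
theorem exists_toLin_eq {A B : Mat n} (hAB : A * B = 1) (hBA : B * A = 1)
    (h : ∀ v w : V n, Phi (A *ᵥ v) (A *ᵥ w) = Phi v w) : ∃ g : Sp n, mat g = A := by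
  refine ⟨⟨⟨A, B, hAB, hBA⟩, ?_⟩, rfl⟩
  change Aᴴ * J n * A = J n
  refine matrix_ext fun v w => ?_
  rw [← Phi_mulVec, h, Phi_eq_dotProduct]

/-! ### Reflections -/

/-- The reflection in a positive (or negative) vector. -/
theorem exists_reflection {f : V n} {a : ℝ} (ha : a ≠ 0) (hf : Phi f f = (a : ℍ[ℝ])) :
    ∃ x : Sp n, (∀ v, toLin x v = v - f <• ((2 / a : ℝ) • Phi f v)) ∧ x * x = 1 := by
  let A : Mat n := 1 - Matrix.vecMulVec f (((2 / a : ℝ) • star f) ᵥ* J n)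
  have hA : ∀ v, A *ᵥ v = v - f <• ((2 / a : ℝ) • Phi f v) := by
    intro v
    simp only [A, Matrix.sub_mulVec, Matrix.one_mulVec, Matrix.vecMulVec_mulVec]
    rw [← Matrix.dotProduct_mulVec, smul_dotProduct, Phi_eq_dotProduct]
  have hAA : A * A = 1 := by
    refine mulVec_ext fun v => ?_
    rw [← Matrix.mulVec_mulVec, Matrix.one_mulVec, hA, hA, Phi_sub_right, Phi_smul_right, hf]
    have : (a : ℍ[ℝ]) * ((2 / a : ℝ) • Phi f v) = (2 : ℝ) • Phi f v := by
      rw [Quaternion.coe_mul_eq_smul, smul_smul]; congr 1; field_simp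
    rw [this, two_smul, sub_add_cancel_left, smul_neg, MulOpposite.op_neg, neg_smul]
    abel
  have hform : ∀ v w : V n, Phi (A *ᵥ v) (A *ᵥ w) = Phi v w := by
    intro v w
    rw [hA, hA]
    simp only [Phi_sub_left, Phi_sub_right, Phi_smul_left, Phi_smul_right, hf]
    rw [← star_Phi f v]
    simp only [Quaternion.star_smul, mul_smul_comm, smul_mul_assoc, Quaternion.mul_coe_eq_smul,
      smul_smul, sub_mul, smul_sub]
    have : 2 / a * (2 / a * a) = 2 / a + 2 / a := by field_simp; norm_num
    simp only [this, add_smul]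
    abel
  obtain ⟨x, hx⟩ := exists_toLin_eq hAA hAA hform
  refine ⟨x, fun v => ?_, ?_⟩
  · rw [← hA, ← hx]; rfl
  · refine toLin_ext fun v => ?_
    rw [toLin_mul, toLin_one]
    change mat x *ᵥ (mat x *ᵥ v) = v
    rw [hx, Matrix.mulVec_mulVec, hAA, Matrix.one_mulVec]

/-! ### Quaternions -/

theorem star_mul_self_of_norm {l : ℍ[ℝ]} (h : ‖l‖ = 1) : star l * l = 1 := by
  rw [Quaternion.star_mul_self, Quaternion.normSq_eq_norm_mul_self, h]; simp

theorem mul_star_self_of_norm {l : ℍ[ℝ]} (h : ‖l‖ = 1) : l * star l = 1 := by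
  rw [Quaternion.self_mul_star, Quaternion.normSq_eq_norm_mul_self, h]; simp

theorem inv_eq_star_of_norm {l : ℍ[ℝ]} (h : ‖l‖ = 1) : l⁻¹ = star l :=
  inv_eq_of_mul_eq_one_right (mul_star_self_of_norm h)

theorem coe_two : ((2 : ℝ) : ℍ[ℝ]) = 1 + 1 := by
  rw [← one_add_one_eq_two, Quaternion.coe_add, Quaternion.coe_one]

theorem mul_self_eq (l : ℍ[ℝ]) : l * l = (2 * l.re) • l - (l.normSq : ℍ[ℝ]) := by
  have h : l + star l = ((2 * l.re : ℝ) : ℍ[ℝ]) := by ext <;> simp; ring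
  rw [← Quaternion.star_mul_self, ← Quaternion.coe_mul_eq_smul, ← h, add_mul, add_sub_cancel_right]

theorem add_star_eq (l : ℍ[ℝ]) : l + star l = ((2 * l.re : ℝ) : ℍ[ℝ]) := by
  ext <;> simp; ring

/-- Every quaternion is conjugated to its conjugate by an imaginary unit. -/
theorem exists_conj_star (l : ℍ[ℝ]) :
    ∃ j : ℍ[ℝ], j * j = -1 ∧ star j = -j ∧ j * l = star l * j := by
  -- The required `j` is any imaginary unit orthogonal to the imaginary part of `l`: rotate its `i,
  -- j`-component by a right angle, or take `i` when that component vanishes.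
  by_cases h : l.imI ^ 2 + l.imJ ^ 2 = 0
  · have hb : l.imI = 0 := by nlinarith [sq_nonneg l.imI, sq_nonneg l.imJ]
    have hc : l.imJ = 0 := by nlinarith [sq_nonneg l.imI, sq_nonneg l.imJ]
    obtain ⟨j, h1, h2, h3, h4⟩ : ∃ j : ℍ[ℝ], j.re = 0 ∧ j.imI = 1 ∧ j.imJ = 0 ∧ j.imK = 0 :=
      ⟨⟨0, 1, 0, 0⟩, rfl, rfl, rfl, rfl⟩
    refine ⟨j, ?_, ?_, ?_⟩ <;> ext <;> simp [hb, hc, h1, h2, h3, h4]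
  · have h0 : 0 < l.imI ^ 2 + l.imJ ^ 2 := lt_of_le_of_ne (by positivity) (Ne.symm h)
    set r := Real.sqrt (l.imI ^ 2 + l.imJ ^ 2) with hr
    have hr0 : 0 < r := Real.sqrt_pos.mpr h0
    have hrr : r * r = l.imI ^ 2 + l.imJ ^ 2 := Real.mul_self_sqrt h0.le
    obtain ⟨j, h1, h2, h3, h4⟩ : ∃ j : ℍ[ℝ],
        j.re = 0 ∧ j.imI = -l.imJ / r ∧ j.imJ = l.imI / r ∧ j.imK = 0 :=
      ⟨⟨0, -l.imJ / r, l.imI / r, 0⟩, rfl, rfl, rfl, rfl⟩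
    refine ⟨j, ?_, ?_, ?_⟩ <;> ext <;> simp [h1, h2, h3, h4] <;> field_simp <;> nlinarith

theorem eq_coe_of_star_eq {l : ℍ[ℝ]} (h : star l = l) : l = (l.re : ℍ[ℝ]) :=
  Quaternion.star_eq_self.mp h

theorem eq_one_or_neg_one_of_star_eq {l : ℍ[ℝ]} (hn : ‖l‖ = 1) (h : star l = l) :
    l = 1 ∨ l = -1 := by
  rw [← mul_self_eq_one_iff]
  conv_lhs => rw [← h]
  rw [h]
  nth_rewrite 1 [← h]
  exact star_mul_self_of_norm hn

theorem normSq_eq_one {l : ℍ[ℝ]} (hn : ‖l‖ = 1) : l.normSq = 1 := by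
  rw [Quaternion.normSq_eq_norm_mul_self, hn, one_mul]

theorem re_sq_lt_one {l : ℍ[ℝ]} (hn : ‖l‖ = 1) (h : star l ≠ l) : l.re ^ 2 < 1 := by
  have h1 := normSq_eq_one hn
  rw [Quaternion.normSq_def'] at h1
  by_contra hcon
  apply h
  have hi : l.imI = 0 := by nlinarith [sq_nonneg l.imI, sq_nonneg l.imJ, sq_nonneg l.imK]
  have hj : l.imJ = 0 := by nlinarith [sq_nonneg l.imI, sq_nonneg l.imJ, sq_nonneg l.imK]
  have hk : l.imK = 0 := by nlinarith [sq_nonneg l.imI, sq_nonneg l.imJ, sq_nonneg l.imK]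
  ext <;> simp [hi, hj, hk]

/-! ### Eigenvectors -/

/-- Makes the space finite-dimensional as a right vector space, so that dimension counts with
`Module.finrank` are meaningful. -/
instance finite_quaternion_mop : Module.Finite ℍ[ℝ]ᵐᵒᵖ ℍ[ℝ] :=
  ⟨⟨{1}, by
    rw [Finset.coe_singleton, eq_top_iff]
    intro x _
    exact Submodule.mem_span_singleton.mpr ⟨MulOpposite.op x, by simp⟩⟩⟩

theorem isEigenvector_iff {g : Sp n} {l : ℍ[ℝ]} {v : V n} :
    IsEigenvector g l v ↔ v ≠ 0 ∧ toLin g v = v <• l := Iff.rfl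

theorem smul_right_eq_zero {v : V n} {c : ℍ[ℝ]} : v <• c = 0 ↔ c = 0 ∨ v = 0 := by
  rw [smul_eq_zero, MulOpposite.op_eq_zero_iff]

theorem smul_right_mul (v : V n) (a b : ℍ[ℝ]) : v <• (a * b) = (v <• a) <• b := by
  rw [MulOpposite.op_mul, mul_smul]

theorem smul_right_inj {v : V n} (hv : v ≠ 0) {a b : ℍ[ℝ]} (h : v <• a = v <• b) : a = b := by
  have : v <• (a - b) = 0 := by rw [MulOpposite.op_sub, sub_smul, h, sub_self]
  exact sub_eq_zero.mp ((smul_right_eq_zero.mp this).resolve_right hv)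

theorem eigenvalue_ne_zero {g : Sp n} {l : ℍ[ℝ]} {v : V n} (hv : v ≠ 0)
    (h : toLin g v = v <• l) : l ≠ 0 := by
  rintro rfl
  rw [MulOpposite.op_zero, zero_smul, toLin_eq_zero] at h
  exact hv h

theorem toLin_inv_eigen {g : Sp n} {l : ℍ[ℝ]} {v : V n} (h : toLin g v = v <• l) :
    toLin g⁻¹ v = v <• l⁻¹ := by
  by_cases hv : v = 0
  · simp [hv]
  have hl := eigenvalue_ne_zero hv h
  have : v = toLin g⁻¹ v <• l := by rw [← toLin_right, ← h, toLin_inv_apply]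
  conv_rhs => rw [this]
  rw [← smul_right_mul, mul_inv_cancel₀ hl, MulOpposite.op_one, one_smul]

/-- Rescaling conjugates the eigenvalue; the form `l * c = c * m` avoids inverting `c`. -/
theorem toLin_eigen_smul {g : Sp n} {l : ℍ[ℝ]} {v : V n} (h : toLin g v = v <• l) (c : ℍ[ℝ])
    {m : ℍ[ℝ]} (hc : l * c = c * m) : toLin g (v <• c) = (v <• c) <• m := by
  rw [toLin_right, h, ← smul_right_mul, ← smul_right_mul, hc]

/-- The main source of orthogonality between eigenvectors: if `Phi v w ≠ 0`, it conjugates `m` to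
the inverse of `star l`. -/
theorem Phi_eigen {g : Sp n} {l m : ℍ[ℝ]} {v w : V n} (hv : toLin g v = v <• l)
    (hw : toLin g w = w <• m) : star l * Phi v w * m = Phi v w := by
  rw [mul_assoc, ← Phi_smul_right, ← Phi_smul_left, ← hv, ← hw, Phi_toLin]

theorem norm_eigenvalue {g : Sp n} {l : ℍ[ℝ]} {v : V n} (hv : toLin g v = v <• l)
    (h : (Phi v v).re ≠ 0) : ‖l‖ = 1 := by
  have h1 := congrArg norm (Phi_eigen hv hv)
  rw [norm_mul, norm_mul, norm_star] at h1
  have h2 : ‖Phi v v‖ ≠ 0 := fun h0 => h (by rw [norm_eq_zero.mp h0]; rfl)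
  have h3 : ‖l‖ * ‖l‖ = 1 := mul_right_cancel₀ h2 (by linarith)
  nlinarith [norm_nonneg l]

/-- The kernel of the real polynomial `x² - 2 t x + m` at `g`. -/
def quadSpace (g : Sp n) (t m : ℝ) : Submodule ℍ[ℝ]ᵐᵒᵖ (V n) where
  -- Real coefficients commute with the right action, so this is a right subspace; with `t = l.re`
  -- and `m = l.normSq` it depends only on the class of `l`.
  carrier := {v | toLin g (toLin g v) = (2 * t) • toLin g v - m • v}
  add_mem' := by
    intro a b ha hb
    simp only [Set.mem_ofPred_eq, map_add, smul_add] at *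
    rw [ha, hb]; abel
  zero_mem' := by simp
  smul_mem' := by
    intro c v hv
    simp only [Set.mem_ofPred_eq, map_smul] at *
    rw [hv, smul_sub, smul_comm c, smul_comm c]

theorem mem_quadSpace {g : Sp n} {t m : ℝ} {v : V n} :
    v ∈ quadSpace g t m ↔ toLin g (toLin g v) = (2 * t) • toLin g v - m • v := Iff.rfl

/-- For `m = 1` the condition is symmetric in `g` and `g⁻¹`. Hence it is preserved by a reversing
involution, and it describes an eigenspace of the self-adjoint map `g + g⁻¹`. -/
theorem mem_quadSpace_one {g : Sp n} {t : ℝ} {v : V n} :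
    v ∈ quadSpace g t 1 ↔ toLin g v + toLin g⁻¹ v = (2 * t) • v := by
  rw [mem_quadSpace, one_smul, ← (toLin_injective g).eq_iff (a := _ + _), map_add,
    toLin_apply_inv, toLin_real, eq_sub_iff_add_eq]

theorem toLin_mem_quadSpace {g : Sp n} {t m : ℝ} {v : V n} (h : v ∈ quadSpace g t m) :
    toLin g v ∈ quadSpace g t m := by
  rw [mem_quadSpace] at *
  rw [h, map_sub, toLin_real, toLin_real, h]

theorem mem_quadSpace_of_eigen {g : Sp n} {l : ℍ[ℝ]} {v : V n} (h : toLin g v = v <• l) :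
    v ∈ quadSpace g l.re l.normSq := by
  rw [mem_quadSpace, h, toLin_right, h, ← smul_right_mul, mul_self_eq, MulOpposite.op_sub,
    sub_smul, smul_coe, MulOpposite.op_smul, smul_assoc]

theorem eigenspace_le_quadSpace (g : Sp n) (l : ℍ[ℝ]) :
    eigenspace g l ≤ quadSpace g l.re l.normSq :=
  Submodule.span_le.mpr fun _ h => mem_quadSpace_of_eigen h

theorem mem_eigenspace_of_eigen {g : Sp n} {l : ℍ[ℝ]} {v : V n} (h : toLin g v = v <• l) :
    v ∈ eigenspace g l := Submodule.subset_span h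

/-- Right multiplications by `l` and `star l` commute with each other and with `g`, so the quadratic
polynomial factors as `(g - l)(g - star l)`, and `g - star l` maps its kernel into the solutions of
`g v = v l`. -/
theorem toLin_sub_star_eigen {g : Sp n} {l : ℍ[ℝ]} {v : V n}
    (h : v ∈ quadSpace g l.re l.normSq) :
    toLin g (toLin g v - v <• star l) = (toLin g v - v <• star l) <• l := by
  rw [map_sub, toLin_right, mem_quadSpace.mp h, smul_sub, ← smul_right_mul,
    Quaternion.star_mul_self, smul_coe]
  have : toLin g v <• l = (2 * l.re) • toLin g v - toLin g v <• star l := by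
    rw [← smul_coe, ← add_star_eq, MulOpposite.op_add, add_smul, add_sub_cancel_right]
  rw [this]; abel

/-- An invariant subspace meeting the kernel of the real quadratic polynomial of `l`
contains an eigenvector for `l`. -/
theorem exists_eigen_of_mem_quadSpace {g : Sp n} {l : ℍ[ℝ]} {v : V n} (hv : v ≠ 0)
    (h : v ∈ quadSpace g l.re l.normSq) {U : Submodule ℍ[ℝ]ᵐᵒᵖ (V n)}
    (hU : ∀ u ∈ U, toLin g u ∈ U) (hvU : v ∈ U) : ∃ e ∈ U, e ≠ 0 ∧ toLin g e = e <• l := by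
  -- Either `g v - v (star l)` is the eigenvector sought, or `v` is an eigenvector for `star l`,
  -- which multiplication by `j` turns into one for `l`.
  by_cases ha : toLin g v - v <• star l = 0
  · obtain ⟨j, hj, -, hjl⟩ := exists_conj_star l
    refine ⟨v <• j, U.smul_mem _ hvU, ?_, ?_⟩
    · rw [Ne, smul_right_eq_zero]
      rintro (h0 | h0)
      · rw [h0] at hj; simp at hj
      · exact hv h0
    · exact toLin_eigen_smul (sub_eq_zero.mp ha) j hjl.symm
  · exact ⟨_, U.sub_mem (hU v hvU) (U.smul_mem _ hvU), ha, toLin_sub_star_eigen h⟩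

/-- For nonreal `l`, a vector of the kernel of the quadratic polynomial of `l` is a combination
of two eigenvectors for `l`. -/
theorem exists_decomp_of_mem_quadSpace {g : Sp n} {l : ℍ[ℝ]} (hl : star l ≠ l) {v : V n}
    (h : v ∈ quadSpace g l.re l.normSq) :
    ∃ a b : V n, ∃ c d : ℍ[ℝ], toLin g a = a <• l ∧ toLin g b = b <• l ∧
      v = a <• c + b <• d := by
  obtain ⟨j, hj, -, hjl⟩ := exists_conj_star l
  have hl0 : l - star l ≠ 0 := sub_ne_zero.mpr (Ne.symm hl)
  have h' : v ∈ quadSpace g (star l).re (star l).normSq := by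
    simpa [Quaternion.normSq_star] using h
  have hb := toLin_sub_star_eigen h'
  rw [star_star] at hb
  -- Interpolation: `(g v - v (star l)) - (g v - v l) = v (l - star l)`, and `l - star l` is
  -- invertible.
  refine ⟨toLin g v - v <• star l, (toLin g v - v <• l) <• j, (l - star l)⁻¹,
    j * (l - star l)⁻¹, toLin_sub_star_eigen h, toLin_eigen_smul hb j hjl.symm, ?_⟩
  rw [← smul_right_mul, ← mul_assoc, hj, neg_one_mul, MulOpposite.op_neg, neg_smul,
    ← sub_eq_add_neg, ← smul_sub, sub_sub_sub_cancel_left, ← sub_smul, ← MulOpposite.op_sub,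
    ← smul_right_mul, mul_inv_cancel₀ hl0, MulOpposite.op_one, one_smul]

/-- Nonreality is essential: for real `l` the polynomial is `(x - l)²`, whose kernel may contain
generalized eigenvectors. -/
theorem eigenspace_eq_quadSpace {g : Sp n} {l : ℍ[ℝ]} (hl : star l ≠ l) :
    eigenspace g l = quadSpace g l.re l.normSq := by
  refine le_antisymm (eigenspace_le_quadSpace g l) fun v hv => ?_
  obtain ⟨a, b, c, d, ha, hb, rfl⟩ := exists_decomp_of_mem_quadSpace hl hv
  exact add_mem (Submodule.smul_mem _ _ (mem_eigenspace_of_eigen ha))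
    (Submodule.smul_mem _ _ (mem_eigenspace_of_eigen hb))

theorem toLin_mem_eigenspace {g : Sp n} {l : ℍ[ℝ]} {v : V n} (h : v ∈ eigenspace g l) :
    toLin g v ∈ eigenspace g l := by
  induction h using Submodule.span_induction with
  | mem x hx =>
    have hx' : toLin g x = x <• l := hx
    rw [hx']; exact Submodule.smul_mem _ _ (mem_eigenspace_of_eigen hx')
  | zero => rw [map_zero]; exact zero_mem _
  | add x y _ _ hx hy => rw [map_add]; exact add_mem hx hy
  | smul c x _ hx => rw [map_smul]; exact Submodule.smul_mem _ _ hx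

theorem mem_eigenspace_of_star_eq {g : Sp n} {l : ℍ[ℝ]} (hl : star l = l) {v : V n} :
    v ∈ eigenspace g l ↔ toLin g v = v <• l := by
  refine ⟨fun h => ?_, mem_eigenspace_of_eigen⟩
  obtain ⟨r, rfl⟩ : ∃ r : ℝ, l = r := ⟨_, eq_coe_of_star_eq hl⟩
  rw [smul_coe]
  induction h using Submodule.span_induction with
  | mem x hx =>
    have hx' : toLin g x = x <• (r : ℍ[ℝ]) := hx
    rw [hx', smul_coe]
  | zero => simp
  | add x y _ _ hx hy => rw [map_add, hx, hy, smul_add]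
  | smul c x _ hx => rw [map_smul, hx, smul_comm]

theorem orthogonal_eigenspace {g : Sp n} {l : ℍ[ℝ]} {p v : V n}
    (h : ∀ e, toLin g e = e <• l → Phi p e = 0) (hv : v ∈ eigenspace g l) : Phi p v = 0 := by
  induction hv using Submodule.span_induction with
  | mem x hx => exact h x hx
  | zero => exact Phi_zero_right p
  | add x y _ _ hx hy => rw [Phi_add_right, hx, hy, add_zero]
  | smul c x _ hx =>
    have := Phi_smul_right p x c.unop
    rw [MulOpposite.op_unop] at this
    rw [this, hx, zero_mul]

/-- By equality of dimensions an injective map carries an invariant subspace onto itself. -/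
theorem toLin_inv_mem {g : Sp n} {U : Submodule ℍ[ℝ]ᵐᵒᵖ (V n)} (hU : ∀ u ∈ U, toLin g u ∈ U)
    {w : V n} (hw : w ∈ U) : toLin g⁻¹ w ∈ U := by
  have hle : U.map (toLin g) ≤ U := Submodule.map_le_iff_le_comap.mpr fun w hw => hU w hw
  have heq : U.map (toLin g) = U :=
    Submodule.eq_of_le_of_finrank_eq hle
      (LinearEquiv.finrank_eq (Submodule.equivMapOfInjective _ (toLin_injective g) _)).symm
  rw [← heq] at hw
  obtain ⟨u, hu, rfl⟩ := hw
  rwa [toLin_inv_apply]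

/-- A null eigenvalue has a null eigenvector. -/
theorem IsNullEigenvalue.exists_null {g : Sp n} {l : ℍ[ℝ]} (h : IsNullEigenvalue g l) :
    ∃ e : V n, e ≠ 0 ∧ toLin g e = e <• l ∧ Phi e e = 0 := by
  obtain ⟨v, hv, hv0, hvo⟩ := h
  -- Vectors of `eigenspace g l` need not be eigenvectors. The radical `U` of the form on it is
  -- invariant and nonzero, hence contains a genuine one.
  let U : Submodule ℍ[ℝ]ᵐᵒᵖ (V n) :=
    { carrier := {u | u ∈ eigenspace g l ∧ ∀ w ∈ eigenspace g l, Phi u w = 0}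
      add_mem' := fun {a b} ha hb =>
        ⟨add_mem ha.1 hb.1, fun w hw => by rw [Phi_add_left, ha.2 w hw, hb.2 w hw, add_zero]⟩
      zero_mem' := ⟨zero_mem _, fun w _ => Phi_zero_left w⟩
      smul_mem' := fun c u hu => ⟨Submodule.smul_mem _ _ hu.1, fun w hw => by
        have := Phi_smul_left u w c.unop
        rw [MulOpposite.op_unop] at this
        rw [this, hu.2 w hw, mul_zero]⟩ }
  have hinv : ∀ w ∈ eigenspace g l, toLin g⁻¹ w ∈ eigenspace g l := fun w hw =>
    toLin_inv_mem (fun _ => toLin_mem_eigenspace) hw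
  have hU : ∀ u ∈ U, toLin g u ∈ U := fun u hu =>
    ⟨toLin_mem_eigenspace hu.1, fun w hw => by rw [Phi_toLin_left]; exact hu.2 _ (hinv w hw)⟩
  obtain ⟨e, he, he0, hel⟩ := exists_eigen_of_mem_quadSpace hv0 (eigenspace_le_quadSpace g l hv)
    hU (show v ∈ U from ⟨hv, hvo⟩)
  exact ⟨e, he0, hel, he.2 e he.1⟩

/-- These are eigenspaces of the self-adjoint map `g + g⁻¹` for the distinct real numbers `2 t` and
`2 t'`. -/
theorem Phi_quadSpace_eq_zero {g : Sp n} {t t' : ℝ} (h : t ≠ t') {v w : V n}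
    (hv : v ∈ quadSpace g t 1) (hw : w ∈ quadSpace g t' 1) : Phi v w = 0 := by
  have h1 := congrArg (fun u => Phi u w) (mem_quadSpace_one.mp hv)
  have h2 := congrArg (fun u => Phi v u) (mem_quadSpace_one.mp hw)
  simp only [Phi_add_left, Phi_add_right, Phi_real_smul_left, Phi_real_smul_right,
    Phi_toLin_left, inv_inv] at h1 h2
  have h3 : (2 * t - 2 * t') • Phi v w = 0 := by rw [sub_smul, ← h1, ← h2]; abel
  exact (smul_eq_zero.mp h3).resolve_left fun h0 => h (by linarith)

/-- Every nonzero invariant subspace contains an eigenvector. -/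
theorem exists_eigenvector {g : Sp n} {U : Submodule ℍ[ℝ]ᵐᵒᵖ (V n)}
    (hU : ∀ u ∈ U, toLin g u ∈ U) (hne : U ≠ ⊥) :
    ∃ e ∈ U, e ≠ 0 ∧ ∃ l : ℍ[ℝ], toLin g e = e <• l := by
  -- Restricting the right action to the commutative subfield `ℂ` makes `U` a complex vector space
  -- on which `g` is linear, so a complex eigenvalue exists.
  let φ : ℂ →+* ℍ[ℝ]ᵐᵒᵖ :=
    (Quaternion.ofComplex.toRingHom).toOpposite fun x y => by
      change _ * _ = _ * _
      rw [← map_mul, mul_comm, map_mul]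
  let _ : Module ℂ U := Module.compHom U φ
  have hφ : ∀ (z : ℂ) (u : U), ((z • u : U) : V n) = (u : V n) <• (z : ℍ[ℝ]) := fun z u => rfl
  have : IsScalarTower ℝ ℂ U := ⟨fun r z u => Subtype.ext (by
    rw [hφ]
    change _ = r • ((z • u : U) : V n)
    rw [hφ, ← smul_coe, ← smul_right_mul]
    congr 2
    rw [Complex.real_smul, Quaternion.coeComplex_mul, Quaternion.coeComplex_coe]
    exact (Quaternion.coe_commutes r _))⟩
  have : Module.Finite ℝ U :=
    Module.Finite.of_injective ((U.restrictScalars ℝ).subtype) Subtype.val_injective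
  have : Module.Finite ℂ U := Module.Finite.of_restrictScalars_finite ℝ ℂ U
  have : Nontrivial U := Submodule.nontrivial_iff_ne_bot.mpr hne
  let f : Module.End ℂ U :=
    { toFun := fun u => ⟨toLin g u, hU u u.2⟩
      map_add' := fun a b => Subtype.ext (map_add (toLin g) (a : V n) b)
      map_smul' := fun z u => Subtype.ext (toLin_right g u z) }
  obtain ⟨z, hz⟩ := Module.End.exists_eigenvalue f
  obtain ⟨u, hu⟩ := hz.exists_hasEigenvector
  refine ⟨u, u.2, fun h => hu.2 (Subtype.ext h), z, ?_⟩
  exact congrArg Subtype.val hu.apply_eq_smul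

/-! ### Orthogonal complements -/

/-- The orthogonal complement of a vector. -/
def perp (e : V n) : Submodule ℍ[ℝ]ᵐᵒᵖ (V n) where
  carrier := {v | Phi e v = 0}
  add_mem' := fun {a b} (ha : _ = _) (hb : _ = _) => by
    change _ = _; rw [Phi_add_right, ha, hb, add_zero]
  zero_mem' := Phi_zero_right e
  smul_mem' := fun c v (hv : _ = _) => by
    have := Phi_smul_right e v c.unop
    rw [MulOpposite.op_unop] at this
    change _ = _
    rw [this, hv, zero_mul]

theorem mem_perp {e v : V n} : v ∈ perp e ↔ Phi e v = 0 := Iff.rfl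

theorem finrank_inf_perp {U : Submodule ℍ[ℝ]ᵐᵒᵖ (V n)} {e : V n} (he : e ∈ U)
    (h1 : Phi e e = 1) : Module.finrank ℍ[ℝ]ᵐᵒᵖ ↥(U ⊓ perp e) + 1 = Module.finrank ℍ[ℝ]ᵐᵒᵖ U := by
  have he0 : e ≠ 0 := by rintro rfl; rw [Phi_zero_left] at h1; exact zero_ne_one h1
  have hsup : (U ⊓ perp e) ⊔ Submodule.span ℍ[ℝ]ᵐᵒᵖ {e} = U := by
    refine le_antisymm (sup_le inf_le_left ?_) fun v hv => ?_
    · rw [Submodule.span_le, Set.singleton_subset_iff]; exact he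
    · rw [Submodule.mem_sup]
      refine ⟨v - e <• Phi e v, ⟨U.sub_mem hv (U.smul_mem _ he), ?_⟩, e <• Phi e v,
        Submodule.smul_mem _ _ (Submodule.mem_span_singleton_self e), sub_add_cancel _ _⟩
      change Phi e _ = 0
      rw [Phi_sub_right, Phi_smul_right, h1, one_mul, sub_self]
  have hinf : (U ⊓ perp e) ⊓ Submodule.span ℍ[ℝ]ᵐᵒᵖ {e} = ⊥ := by
    rw [eq_bot_iff]
    rintro v ⟨⟨-, hv⟩, hv'⟩
    obtain ⟨c, rfl⟩ := Submodule.mem_span_singleton.mp hv'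
    have := Phi_smul_right e e c.unop
    rw [MulOpposite.op_unop, h1, one_mul, mem_perp.mp hv] at this
    have hc : c = 0 := MulOpposite.unop_injective this.symm
    simp [hc]
  have := Submodule.finrank_sup_add_finrank_inf_eq (U ⊓ perp e) (Submodule.span ℍ[ℝ]ᵐᵒᵖ {e})
  rw [hsup, hinf, finrank_bot, finrank_span_singleton he0] at this
  omega

/-- Normalization of a positive vector. -/
theorem exists_normalize {v : V n} (h : 0 < (Phi v v).re) :
    ∃ r : ℝ, r ≠ 0 ∧ Phi (r • v) (r • v) = 1 := by
  refine ⟨(Real.sqrt (Phi v v).re)⁻¹, inv_ne_zero (Real.sqrt_pos.mpr h).ne', ?_⟩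
  have hs := Real.mul_self_sqrt h.le
  set s := (Phi v v).re with hsdef
  have hself : Phi v v = (s : ℍ[ℝ]) := Phi_self v
  rw [Phi_real_smul_left, Phi_real_smul_right, hself, smul_smul, ← mul_inv, hs,
    ← Quaternion.coe_smul, smul_eq_mul, inv_mul_cancel₀ h.ne', Quaternion.coe_one]

theorem toLin_eigen_real {g : Sp n} {l : ℍ[ℝ]} {v : V n} (h : toLin g v = v <• l) (r : ℝ) :
    toLin g (r • v) = (r • v) <• l := by
  rw [toLin_real, h, smul_comm]

/-! ### Involutions reversing `g` -/

/-- `x` is an involution with `(x g)² = 1`. -/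
def Reverses (x g : Sp n) : Prop :=
  x * x = 1 ∧ ∀ v, toLin x (toLin g (toLin x (toLin g v))) = v

theorem stronglyReversible_iff {g : Sp n} : StronglyReversible g ↔ ∃ x, Reverses x g := by
  constructor
  · rintro ⟨x, hx, h⟩
    rw [sq] at hx
    refine ⟨x, hx, fun v => ?_⟩
    have : x⁻¹ = x := inv_eq_of_mul_eq_one_right hx
    rw [this] at h
    rw [← toLin_mul, ← toLin_mul, ← toLin_mul, ← h, inv_mul_cancel, toLin_one]
  · rintro ⟨x, hx, h⟩
    refine ⟨x, by rw [sq, hx], ?_⟩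
    have : x⁻¹ = x := inv_eq_of_mul_eq_one_right hx
    rw [this]
    refine inv_eq_of_mul_eq_one_left (toLin_ext fun v => ?_)
    rw [toLin_mul, toLin_mul, toLin_mul, toLin_one, h]

theorem Reverses.inv_eq {x g : Sp n} (h : Reverses x g) : x⁻¹ = x :=
  inv_eq_of_mul_eq_one_right h.1

theorem Reverses.apply_apply {x g : Sp n} (h : Reverses x g) (v : V n) :
    toLin x (toLin x v) = v := by rw [← toLin_mul, h.1, toLin_one]

theorem Reverses.comm {x g : Sp n} (h : Reverses x g) (v : V n) :
    toLin g (toLin x v) = toLin x (toLin g⁻¹ v) := by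
  have := h.2 (toLin g⁻¹ v)
  rw [toLin_apply_inv] at this
  rw [← h.apply_apply (toLin g (toLin x v)), this]

theorem Reverses.comm_inv {x g : Sp n} (h : Reverses x g) (v : V n) :
    toLin g⁻¹ (toLin x v) = toLin x (toLin g v) := by
  have := h.comm (toLin g v)
  rw [toLin_inv_apply] at this
  rw [← this, toLin_inv_apply]

theorem Reverses.eigen {x g : Sp n} (h : Reverses x g) {e : V n} {l : ℍ[ℝ]}
    (he : toLin g e = e <• l) : toLin g (toLin x e) = toLin x e <• l⁻¹ := by
  rw [h.comm, toLin_inv_eigen he, toLin_right]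

theorem Reverses.Phi_symm {x g : Sp n} (h : Reverses x g) (v w : V n) :
    Phi (toLin x v) w = Phi v (toLin x w) := by
  rw [Phi_toLin_left, h.inv_eq]

/-- Since `x` is self-adjoint, `Phi e (x e)` is real. As `x e` has eigenvalue `l⁻¹ = star l`,
invariance under `g` multiplies this real number by `star (l * l)`, so it vanishes unless `l² = 1`.
-/
theorem Reverses.Phi_orthogonal {x g : Sp n} (h : Reverses x g) {e : V n} {l : ℍ[ℝ]}
    (hl : ‖l‖ = 1) (he : toLin g e = e <• l) :
    Phi e (toLin x e) = 0 ∨ l = 1 ∨ l = -1 := by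
  have h1 : star (Phi e (toLin x e)) = Phi e (toLin x e) := by rw [star_Phi, h.Phi_symm]
  have h2 := Phi_eigen he (h.eigen he)
  rw [inv_eq_star_of_norm hl, eq_coe_of_star_eq h1, ← Quaternion.coe_commutes, mul_assoc,
    ← star_mul] at h2
  have h3 : ((Phi e (toLin x e)).re : ℍ[ℝ]) * (star (l * l) - 1) = 0 := by
    rw [mul_sub, h2, mul_one, sub_self]
  rcases mul_eq_zero.mp h3 with h4 | h4
  · left; rw [eq_coe_of_star_eq h1, h4]
  · right
    rw [← mul_self_eq_one_iff]
    rw [sub_eq_zero] at h4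
    rw [← star_star (l * l), h4, star_one]

theorem toLin_mem_perp {g : Sp n} {e w : V n} {l : ℍ[ℝ]} (he : toLin g e = e <• l)
    (hw : w ∈ perp e) : toLin g w ∈ perp e := by
  rw [mem_perp, Phi_toLin_right, toLin_inv_eigen he, Phi_smul_left, mem_perp.mp hw, mul_zero]

/-- An involution reversing `g` forces nonreal eigenvalues of positive type to have even
multiplicity. -/
theorem Reverses.even_finrank {x g : Sp n} (h : Reverses x g) {l : ℍ[ℝ]} (hl : ‖l‖ = 1)
    (hl1 : ¬(l = 1 ∨ l = -1)) (d : ℕ) : ∀ U : Submodule ℍ[ℝ]ᵐᵒᵖ (V n),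
      Module.finrank ℍ[ℝ]ᵐᵒᵖ U = d → U ≤ quadSpace g l.re l.normSq →
      (∀ u ∈ U, toLin g u ∈ U) → (∀ u ∈ U, toLin x u ∈ U) →
      (∀ e ∈ U, e ≠ 0 → toLin g e = e <• l → 0 < (Phi e e).re) → Even d := by
  induction d using Nat.strong_induction_on with
  | _ d ih =>
  intro U hd hUq hUg hUx hpos
  by_cases hU : U = ⊥
  · rw [hU, finrank_bot] at hd
    rw [← hd]; exact Even.zero
  obtain ⟨v, hv, hv0⟩ := Submodule.exists_mem_ne_zero_of_ne_bot hU
  obtain ⟨e₀, he₀, he₀0, he₀g⟩ := exists_eigen_of_mem_quadSpace hv0 (hUq hv) hUg hv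
  obtain ⟨r, hr, hr1⟩ := exists_normalize (hpos e₀ he₀ he₀0 he₀g)
  obtain ⟨j, hj, hjs, hjl⟩ := exists_conj_star l
  set e := r • e₀ with he
  have heU : e ∈ U := by rw [he, ← smul_coe]; exact U.smul_mem _ he₀
  have heg : toLin g e = e <• l := toLin_eigen_real he₀g r
  -- `x e` has eigenvalue `star l`, and `j` brings it back to `l`. The plane spanned by `e` and `e'`
  -- is stable under `g` and `x`, so its complement in `U` has dimension smaller by two.
  set e' := toLin x e <• j with he'
  have he'U : e' ∈ U := U.smul_mem _ (hUx e heU)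
  have he'g : toLin g e' = e' <• l := by
    refine toLin_eigen_smul (h.eigen heg) j ?_
    rw [inv_eq_star_of_norm hl, hjl]
  have h0 : Phi e (toLin x e) = 0 := (h.Phi_orthogonal hl heg).resolve_right hl1
  have hee' : Phi e e' = 0 := by rw [he', Phi_smul_right, h0, zero_mul]
  have he'e' : Phi e' e' = 1 := by
    rw [he', Phi_smul_left, Phi_smul_right, Phi_toLin, hr1, one_mul, hjs, neg_mul, hj, neg_neg]
  have hxe : toLin x e = e' <• (-j) := by
    rw [he', ← smul_right_mul, mul_neg, hj, neg_neg, MulOpposite.op_one, one_smul]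
  have h1 := finrank_inf_perp heU hr1
  have h2 := finrank_inf_perp (U := U ⊓ perp e) (e := e') ⟨he'U, hee'⟩ he'e'
  have hlt : Module.finrank ℍ[ℝ]ᵐᵒᵖ ↥(U ⊓ perp e ⊓ perp e') < d := by omega
  obtain ⟨k, hk⟩ := ih _ hlt (U ⊓ perp e ⊓ perp e') rfl
    ((inf_le_left.trans inf_le_left).trans hUq)
    (fun u hu => ⟨⟨hUg u hu.1.1, toLin_mem_perp heg hu.1.2⟩, toLin_mem_perp he'g hu.2⟩)
    (fun u hu => ⟨⟨hUx u hu.1.1, by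
        change Phi e (toLin x u) = 0
        rw [← h.Phi_symm, hxe, Phi_smul_left, mem_perp.mp hu.2, mul_zero]⟩, by
        change Phi e' (toLin x u) = 0
        rw [he', Phi_smul_left, Phi_toLin, mem_perp.mp hu.1.2, mul_zero]⟩)
    (fun u hu => hpos u hu.1.1)
  exact ⟨k + 1, by omega⟩

theorem Reverses.quadSpace {x g : Sp n} (h : Reverses x g) {t : ℝ} {v : V n}
    (hv : v ∈ quadSpace g t 1) : toLin x v ∈ QuatHyp.quadSpace g t 1 := by
  rw [mem_quadSpace_one] at *
  rw [h.comm, h.comm_inv, ← map_add, ← toLin_real, ← hv, add_comm (toLin g⁻¹ v)]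

/-- A strongly reversible element satisfies the condition on positive classes. -/
theorem Reverses.positiveClassCondition {x g : Sp n} (h : Reverses x g) :
    PositiveClassCondition g := by
  rintro l ⟨⟨v, hv0, hv⟩, hpos⟩
  have hn : ‖l‖ = 1 := norm_eigenvalue hv (hpos v ⟨hv0, hv⟩).ne'
  by_cases h1 : l = 1 ∨ l = -1
  · rcases h1 with h1 | h1 <;> simp [h1]
  · right; right
    have hs : star l ≠ l := fun hs => h1 (eq_one_or_neg_one_of_star_eq hn hs)
    have hN := normSq_eq_one hn
    unfold multiplicity
    rw [eigenspace_eq_quadSpace hs]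
    refine h.even_finrank hn h1 _ _ rfl le_rfl (fun u hu => toLin_mem_quadSpace hu) ?_
      (fun e _ he0 he => hpos e ⟨he0, he⟩)
    rw [hN]
    exact fun u hu => h.quadSpace hu

/-! ### Extending a reversing involution across a positive definite complement -/

/-- Decomposition of a vector orthogonal to `W ∩ e^⊥`. -/
theorem Phi_sub_proj {W : Submodule ℍ[ℝ]ᵐᵒᵖ (V n)} {e v : V n} (he : e ∈ W) (h1 : Phi e e = 1)
    (hv : ∀ w ∈ W ⊓ perp e, Phi w v = 0) : ∀ w ∈ W, Phi w (v - e <• Phi e v) = 0 := by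
  intro w hw
  have hw' : w - e <• Phi e w ∈ W ⊓ perp e := by
    refine ⟨W.sub_mem hw (W.smul_mem _ he), ?_⟩
    change Phi e _ = 0
    rw [Phi_sub_right, Phi_smul_right, h1, one_mul, sub_self]
  have := hv _ hw'
  rw [Phi_sub_left, Phi_smul_left, star_Phi, sub_eq_zero] at this
  rw [Phi_sub_right, Phi_smul_right, this, sub_self]

/-- Extension of a reversing involution from the orthogonal complement of an invariant positive
definite subspace `W`, the nonreal classes of `W` having even multiplicity. -/
theorem exists_reverses {g : Sp n} (d : ℕ) : ∀ (W : Submodule ℍ[ℝ]ᵐᵒᵖ (V n)) (x₀ : Sp n),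
    Module.finrank ℍ[ℝ]ᵐᵒᵖ W = d → x₀ * x₀ = 1 →
    (∀ w ∈ W, w ≠ 0 → 0 < (Phi w w).re) → (∀ w ∈ W, toLin g w ∈ W) →
    (∀ w ∈ W, toLin x₀ w = w) →
    (∀ v, (∀ w ∈ W, Phi w v = 0) → toLin x₀ (toLin g (toLin x₀ (toLin g v))) = v) →
    (∀ t : ℝ, t ^ 2 < 1 → Even (Module.finrank ℍ[ℝ]ᵐᵒᵖ ↥(quadSpace g t 1 ⊓ W))) →
    ∃ x, Reverses x g := by
  induction d using Nat.strong_induction_on with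
  | _ d ih =>
  intro W x₀ hd hx₀ hpos hWg hWx hperp heven
  by_cases hW : W = ⊥
  · refine ⟨x₀, hx₀, fun v => hperp v fun w hw => ?_⟩
    rw [hW, Submodule.mem_bot] at hw
    rw [hw, Phi_zero_left]
  obtain ⟨e₀, he₀, he₀0, l, he₀g⟩ := exists_eigenvector hWg hW
  have hl : ‖l‖ = 1 := norm_eigenvalue he₀g (hpos e₀ he₀ he₀0).ne'
  have hN := normSq_eq_one hl
  obtain ⟨r, -, hee⟩ := exists_normalize (hpos e₀ he₀ he₀0)
  set e := r • e₀ with he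
  have heW : e ∈ W := by rw [he, ← smul_coe]; exact W.smul_mem _ he₀
  have heg : toLin g e = e <• l := toLin_eigen_real he₀g r
  have heq : e ∈ quadSpace g l.re 1 := by
    have := mem_quadSpace_of_eigen heg
    rwa [hN] at this
  have hr1 := finrank_inf_perp heW hee
  -- Classes with another real part are orthogonal to `u`, so splitting off `u` does not change
  -- their dimensions.
  have hdrop : ∀ {u : V n} {s t : ℝ} (X : Submodule ℍ[ℝ]ᵐᵒᵖ (V n)), u ∈ quadSpace g s 1 → s ≠ t →
      quadSpace g t 1 ⊓ (X ⊓ perp u) = quadSpace g t 1 ⊓ X := by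
    intro u s t X hu hst
    refine le_antisymm (inf_le_inf_left _ inf_le_left) fun v hv => ⟨hv.1, hv.2, ?_⟩
    exact Phi_quadSpace_eq_zero hst hu hv.1
  -- For real `l` one has `l = ±1`, and `x₀`, which fixes `e`, already reverses `g` there because
  -- `l² = 1`.
  by_cases hs : star l = l
  · have hl1 : l * l = 1 := mul_self_eq_one_iff.mpr (eq_one_or_neg_one_of_star_eq hl hs)
    refine ih _ (by omega) (W ⊓ perp e) x₀ rfl hx₀ (fun w hw => hpos w hw.1)
      (fun w hw => ⟨hWg w hw.1, toLin_mem_perp heg hw.2⟩) (fun w hw => hWx w hw.1)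
      (fun v hv => ?_) (fun t ht => ?_)
    · have h1 := hperp _ (Phi_sub_proj heW hee hv)
      simp only [map_sub, toLin_right, heg, hWx e heW] at h1
      rw [← smul_right_mul e, hl1, MulOpposite.op_one, one_smul] at h1
      exact sub_left_injective h1
    · rw [hdrop W heq]
      · exact heven t ht
      · rintro rfl
        have h2 : l.re * l.re = 1 := by
          rw [eq_coe_of_star_eq hs, ← Quaternion.coe_mul] at hl1
          exact Quaternion.coe_injective hl1
        nlinarith
  · have ht := re_sq_lt_one hl hs
    set K := quadSpace g l.re 1 with hK
    have hr2 := finrank_inf_perp (U := K ⊓ W) ⟨heq, heW⟩ hee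
    -- The class of `l` has even dimension in `W` and contains `e`, so a second eigenvector
    -- orthogonal to `e` exists.
    have hne : K ⊓ W ⊓ perp e ≠ ⊥ := by
      intro h0
      have h1 := heven _ ht
      rw [← hr2, h0, finrank_bot] at h1
      exact absurd h1 (by decide)
    obtain ⟨v, hv, hv0⟩ := Submodule.exists_mem_ne_zero_of_ne_bot hne
    obtain ⟨e₁, he₁, he₁0, he₁g⟩ := exists_eigen_of_mem_quadSpace (l := l) hv0
      (by rw [hN]; exact hv.1.1) (U := K ⊓ W ⊓ perp e)
      (fun u hu => ⟨⟨toLin_mem_quadSpace hu.1.1, hWg u hu.1.2⟩, toLin_mem_perp heg hu.2⟩) hv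
    obtain ⟨r', -, hee'⟩ := exists_normalize (hpos e₁ he₁.1.2 he₁0)
    set e' := r' • e₁ with he'
    have he'm : e' ∈ K ⊓ W ⊓ perp e := by
      rw [he', ← smul_coe]; exact Submodule.smul_mem _ _ he₁
    have he'g : toLin g e' = e' <• l := toLin_eigen_real he₁g r'
    have he'W := he'm.1.2
    have hort : Phi e e' = 0 := he'm.2
    have hort' : Phi e' e = 0 := Phi_comm_eq_zero hort
    have hr3 := finrank_inf_perp (U := K ⊓ W ⊓ perp e) he'm hee'
    obtain ⟨j, hj, hjs, hjl⟩ := exists_conj_star l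
    have hjl' : l * j = j * star l := by
      have h1 : j * (j * l) * j = j * (star l * j) * j := by rw [hjl]
      rw [← mul_assoc, hj, neg_one_mul, mul_assoc (j : ℍ[ℝ]), mul_assoc (star l), hj,
        mul_neg_one, mul_neg, neg_mul, neg_inj] at h1
      exact h1
    have hjl4 : j * (l * j * l) = -1 := by
      rw [hjl', mul_assoc, star_mul_self_of_norm hl, mul_one, hj]
    -- `e` and `e' j` are orthogonal unit vectors with eigenvalues `l` and `star l = l⁻¹`; the
    -- reflection in their difference exchanges them.
    set f := e - e' <• j with hf
    have hff : Phi f f = ((2 : ℝ) : ℍ[ℝ]) := by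
      simp only [hf, Phi_sub_left, Phi_sub_right, Phi_smul_left, Phi_smul_right, hee, hee', hort,
        hort', hjs, mul_zero, sub_zero, neg_mul, zero_sub, mul_one, hj]
      rw [sub_neg_eq_add, neg_neg, coe_two]
    have hfW : f ∈ W := W.sub_mem heW (W.smul_mem _ he'W)
    obtain ⟨R, hR, hRR⟩ := exists_reflection two_ne_zero hff
    have hR' : ∀ v, toLin R v = v - f <• Phi f v := by
      intro v; rw [hR, div_self two_ne_zero, one_smul]
    have hRe : toLin R e = e' <• j := by
      have : Phi f e = 1 := by
        rw [hf, Phi_sub_left, Phi_smul_left, hort', mul_zero, hee, sub_zero]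
      rw [hR', this, MulOpposite.op_one, one_smul, hf, sub_sub_cancel]
    have hRe' : toLin R e' = -(e <• j) := by
      have : Phi f e' = j := by
        rw [hf, Phi_sub_left, Phi_smul_left, hort, hee', hjs, mul_one, zero_sub, neg_neg]
      rw [hR', this, hf, smul_sub, ← smul_right_mul, hj, MulOpposite.op_neg, MulOpposite.op_one,
        neg_smul, one_smul]
      abel
    have hRid : ∀ v, Phi f v = 0 → toLin R v = v := by
      intro v hv; rw [hR', hv, MulOpposite.op_zero, zero_smul, sub_zero]
    have hxinv : x₀⁻¹ = x₀ := inv_eq_of_mul_eq_one_right hx₀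
    have hxPhi : ∀ w ∈ W, ∀ v, Phi w (toLin x₀ v) = Phi w v := by
      intro w hw v; rw [Phi_toLin_right, hxinv, hWx w hw]
    have hxx : ∀ v, toLin x₀ (toLin x₀ v) = v := fun v => by
      rw [← toLin_mul, hx₀, toLin_one]
    -- `x₀` fixes `f`, hence commutes with the reflection `R`.
    have hx1 : (x₀ * R) * (x₀ * R) = 1 := by
      refine toLin_ext fun v => ?_
      have hcomm : toLin R (toLin x₀ (toLin R v)) = toLin x₀ v := by
        rw [hR' (toLin x₀ _), hxPhi f hfW, hR' v, map_sub, toLin_right, hWx f hfW, Phi_sub_right,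
          Phi_smul_right, hff]
        have : ((2 : ℝ) : ℍ[ℝ]) * Phi f v = Phi f v + Phi f v := by
          rw [Quaternion.coe_mul_eq_smul, two_smul]
        rw [this, MulOpposite.op_sub, MulOpposite.op_add, sub_smul, add_smul]
        abel
      rw [toLin_mul, toLin_mul, toLin_mul, hcomm, hxx, toLin_one]
    refine ih _ ?_ (W ⊓ perp e ⊓ perp e') (x₀ * R) rfl hx1 (fun w hw => hpos w hw.1.1)
      (fun w hw => ⟨⟨hWg w hw.1.1, toLin_mem_perp heg hw.1.2⟩, toLin_mem_perp he'g hw.2⟩)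
      (fun w hw => ?_) (fun v hv => ?_) (fun t ht' => ?_)
    · have := finrank_inf_perp (U := W ⊓ perp e) ⟨he'W, hort⟩ hee'
      omega
    · rw [toLin_mul, hRid, hWx w hw.1.1]
      rw [hf, Phi_sub_left, Phi_smul_left, mem_perp.mp hw.2, mem_perp.mp hw.1.2, mul_zero, sub_zero]
    · have h1 := Phi_sub_proj (W := W ⊓ perp e) ⟨he'W, hort⟩ hee' hv
      have h2 := Phi_sub_proj heW hee h1
      set v₁ := v - e' <• Phi e' v with hv₁
      set v₂ := v₁ - e <• Phi e v₁ with hv₂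
      have hg2 : ∀ w ∈ W, Phi w (toLin g v₂) = 0 := fun w hw => by
        rw [Phi_toLin_right]; exact h2 _ (toLin_inv_mem hWg hw)
      -- The component `v₂` and its successive images stay orthogonal to `W`, where `R` acts
      -- trivially and the hypothesis on `x₀` applies.
      have hg3 : ∀ w ∈ W, Phi w (toLin g (toLin x₀ (toLin g v₂))) = 0 := fun w hw => by
        rw [Phi_toLin_right, hxPhi _ (toLin_inv_mem hWg hw)]
        exact hg2 _ (toLin_inv_mem hWg hw)
      have hTv₂ : toLin (x₀ * R) (toLin g (toLin (x₀ * R) (toLin g v₂))) = v₂ := by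
        rw [toLin_mul, toLin_mul, hRid _ (hg2 f hfW), hRid _ (hg3 f hfW), hperp v₂ h2]
      have hTe : toLin (x₀ * R) (toLin g (toLin (x₀ * R) (toLin g e))) = e := by
        simp only [toLin_mul, heg, toLin_right, hRe, hWx e' he'W, he'g, hRe', map_neg, hWx e heW]
        simp only [smul_neg, ← smul_right_mul]
        rw [mul_assoc (j * l), mul_assoc j, ← mul_assoc l, hjl4]
        rw [MulOpposite.op_neg, neg_smul, MulOpposite.op_one, one_smul, neg_neg]
      have hTe' : toLin (x₀ * R) (toLin g (toLin (x₀ * R) (toLin g e'))) = e' := by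
        simp only [toLin_mul, heg, toLin_right, hRe, hWx e' he'W, he'g, hRe', map_neg, hWx e heW,
          smul_neg]
        simp only [← smul_right_mul]
        rw [mul_assoc (j * l), mul_assoc j, ← mul_assoc l, hjl4]
        rw [MulOpposite.op_neg, neg_smul, MulOpposite.op_one, one_smul, neg_neg]
      have hv : v = v₂ + e <• Phi e v₁ + e' <• Phi e' v := by rw [hv₂, hv₁]; abel
      rw [hv]
      simp only [map_add, toLin_right, hTv₂, hTe, hTe']
    -- Only the class with real part `l.re` shrinks, and it loses exactly two dimensions.
    · by_cases htt : l.re = t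
      · subst htt
        have h1 := heven _ ht
        rw [← hr2, ← hr3] at h1
        rw [← inf_assoc, ← inf_assoc]
        rw [add_assoc, Nat.even_add] at h1
        exact h1.mpr (by decide)
      · rw [hdrop _ he'm.1.1 htt, hdrop _ heq htt]
        exact heven t ht'

/-! ### Fixed points -/

/-- `v` spans a fixed point of `g` on the boundary. -/
def IsFixedNull (g : Sp n) (v : V n) : Prop :=
  v ≠ 0 ∧ Phi v v = 0 ∧ ∃ l : ℍ[ℝ], toLin g v = v <• l

theorem act_mk_eq_iff {g : Sp n} {v : V n} (hv : v ≠ 0) :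
    act g (Projectivization.mk ℍ[ℝ]ᵐᵒᵖ v hv) = Projectivization.mk ℍ[ℝ]ᵐᵒᵖ v hv ↔
      ∃ l : ℍ[ℝ], toLin g v = v <• l := by
  rw [act, Projectivization.map_mk, Projectivization.mk_eq_mk_iff']
  exact ⟨fun ⟨a, ha⟩ => ⟨a.unop, ha.symm⟩, fun ⟨l, hl⟩ => ⟨MulOpposite.op l, hl.symm⟩⟩

theorem mk_eq_mk_iff_right {v w : V n} (hv : v ≠ 0) (hw : w ≠ 0) :
    Projectivization.mk ℍ[ℝ]ᵐᵒᵖ v hv = Projectivization.mk ℍ[ℝ]ᵐᵒᵖ w hw ↔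
      ∃ c : ℍ[ℝ], v = w <• c := by
  rw [Projectivization.mk_eq_mk_iff']
  exact ⟨fun ⟨a, ha⟩ => ⟨a.unop, ha.symm⟩, fun ⟨l, hl⟩ => ⟨MulOpposite.op l, hl.symm⟩⟩

theorem isElliptic_iff {g : Sp n} :
    IsElliptic g ↔ ∃ (v : V n) (l : ℍ[ℝ]), (Phi v v).re < 0 ∧ toLin g v = v <• l := by
  constructor
  · rintro ⟨_, ⟨v, hv, hneg, rfl⟩, hact⟩
    obtain ⟨l, hl⟩ := (act_mk_eq_iff hv).mp hact
    exact ⟨v, l, hneg, hl⟩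
  · rintro ⟨v, l, hneg, hl⟩
    have hv : v ≠ 0 := by rintro rfl; rw [Phi_zero_left] at hneg; simp at hneg
    exact ⟨_, ⟨v, hv, hneg, rfl⟩, (act_mk_eq_iff hv).mpr ⟨l, hl⟩⟩

theorem mem_fixed_boundary_iff {g : Sp n} {P : PV n} :
    P ∈ {p ∈ boundary n | act g p = p} ↔
      ∃ (v : V n) (h : IsFixedNull g v), Projectivization.mk ℍ[ℝ]ᵐᵒᵖ v h.1 = P := by
  constructor
  · rintro ⟨⟨v, hv, h0, rfl⟩, hact⟩
    exact ⟨v, ⟨hv, h0, (act_mk_eq_iff hv).mp hact⟩, rfl⟩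
  · rintro ⟨v, h, rfl⟩
    exact ⟨⟨v, h.1, h.2.1, rfl⟩, (act_mk_eq_iff h.1).mpr h.2.2⟩

theorem IsParabolic.exists_unique {g : Sp n} (h : IsParabolic g) :
    ∃ p, IsFixedNull g p ∧ ∀ q, IsFixedNull g q → ∃ c : ℍ[ℝ], q = p <• c := by
  obtain ⟨P, hP⟩ := Set.encard_eq_one.mp h
  obtain ⟨p, hp, rfl⟩ := mem_fixed_boundary_iff.mp (hP ▸ Set.mem_singleton P)
  refine ⟨p, hp, fun q hq => ?_⟩
  have hq' := mem_fixed_boundary_iff.mpr ⟨q, hq, rfl⟩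
  rw [hP] at hq'
  exact (mk_eq_mk_iff_right hq.1 hp.1).mp hq'

theorem IsHyperbolic.exists_pair {g : Sp n} (h : IsHyperbolic g) :
    ∃ p q, IsFixedNull g p ∧ IsFixedNull g q ∧ Phi p q ≠ 0 ∧
      ∀ r, IsFixedNull g r → (∃ c : ℍ[ℝ], r = p <• c) ∨ ∃ c : ℍ[ℝ], r = q <• c := by
  obtain ⟨P, Q, hPQ, hS⟩ := Set.encard_eq_two.mp h
  obtain ⟨p, hp, rfl⟩ := mem_fixed_boundary_iff.mp (hS ▸ Set.mem_insert P {Q})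
  obtain ⟨q, hq, rfl⟩ := mem_fixed_boundary_iff.mp
    (hS ▸ Set.mem_insert_of_mem _ (Set.mem_singleton Q))
  refine ⟨p, q, hp, hq, fun h0 => hPQ ?_, fun r hr => ?_⟩
  · exact ((mk_eq_mk_iff_right hq.1 hp.1).mpr
      (exists_eq_smul_of_null hp.1 hp.2.1 hq.2.1 h0)).symm
  · have hr' := mem_fixed_boundary_iff.mpr ⟨r, hr, rfl⟩
    rw [hS] at hr'
    rcases hr' with hr' | hr'
    · exact Or.inl ((mk_eq_mk_iff_right hr.1 hp.1).mp hr')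
    · exact Or.inr ((mk_eq_mk_iff_right hr.1 hq.1).mp hr')

theorem Reverses.isFixedNull {x g : Sp n} (h : Reverses x g) {p : V n} (hp : IsFixedNull g p) :
    IsFixedNull g (toLin x p) := by
  obtain ⟨h0, h1, l, hl⟩ := hp
  exact ⟨fun h => h0 (toLin_eq_zero.mp h), by rw [Phi_toLin, h1], l⁻¹, h.eigen hl⟩

/-- From `x² = 1` one gets `a = ±1`, which is central, so comparing the eigenvalues of `p` and `x p`
gives `l = l⁻¹`. -/
theorem Reverses.eigenvalue_of_fixed {x g : Sp n} (h : Reverses x g) {p : V n} (hp : p ≠ 0)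
    {l a : ℍ[ℝ]} (hl : toLin g p = p <• l) (ha : toLin x p = p <• a) :
    (a = 1 ∨ a = -1) ∧ (l = 1 ∨ l = -1) := by
  have haa : a = 1 ∨ a = -1 := by
    rw [← mul_self_eq_one_iff]
    have h1 := h.apply_apply p
    rw [ha, toLin_right, ha, ← smul_right_mul] at h1
    exact smul_right_inj hp (by rw [h1, MulOpposite.op_one, one_smul])
  refine ⟨haa, ?_⟩
  have h2 := h.eigen hl
  rw [ha, toLin_right, hl, ← smul_right_mul, ← smul_right_mul] at h2
  have h3 := smul_right_inj hp h2
  have hll : l = l⁻¹ := by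
    rcases haa with rfl | rfl
    · simpa using h3
    · simpa using h3
  rw [← mul_self_eq_one_iff]
  nth_rewrite 2 [hll]
  exact mul_inv_cancel₀ (eigenvalue_ne_zero hp hl)

/-- `Phi p (x p) = d c` is real because `x` is self-adjoint, and invariance under `g` gives `star l
* (d c) = (d c) * l`; a nonzero real factor cancels. -/
theorem Reverses.star_eigenvalue_of_swap {x g : Sp n} (h : Reverses x g) {p q : V n}
    (hpq : Phi p q ≠ 0) {l m c : ℍ[ℝ]} (hl : toLin g p = p <• l)
    (hm : toLin g q = q <• m) (hc : toLin x p = q <• c) : star l = l := by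
  have hp : p ≠ 0 := by rintro rfl; exact hpq (Phi_zero_left q)
  have hq : q ≠ 0 := by rintro rfl; exact hpq (Phi_zero_right p)
  have hl0 := eigenvalue_ne_zero hp hl
  have hc0 : c ≠ 0 := by
    rintro rfl
    rw [MulOpposite.op_zero, zero_smul, toLin_eq_zero] at hc
    exact hp hc
  set d := Phi p q with hd
  have h1 : star (d * c) = d * c := by
    have h2 := h.Phi_symm p p
    rw [hc, Phi_smul_left, Phi_smul_right, ← star_Phi p q, ← star_mul] at h2
    exact h2
  have h2 : m * c = c * l⁻¹ := by
    have := h.eigen hl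
    rw [hc, toLin_right, hm, ← smul_right_mul, ← smul_right_mul] at this
    exact smul_right_inj hq this
  have h3 : star l * (d * c) = (d * c) * l := by
    have := Phi_eigen hl hm
    rw [← hd] at this
    calc star l * (d * c) = star l * d * (c * l⁻¹) * l := by
          rw [mul_assoc (star l * d), mul_assoc c, inv_mul_cancel₀ hl0, mul_one, mul_assoc]
      _ = star l * d * m * c * l := by rw [← h2, ← mul_assoc]
      _ = d * c * l := by rw [this]
  have hdc : d * c ≠ 0 := mul_ne_zero hpq hc0
  rw [eq_coe_of_star_eq h1, ← Quaternion.coe_commutes] at h3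
  rw [eq_coe_of_star_eq h1] at hdc
  exact mul_left_cancel₀ hdc h3

theorem eigenvalue_of_smul {g : Sp n} {p : V n} {l c m : ℍ[ℝ]} (hl : toLin g p = p <• l)
    (hs : star l = l) (h0 : p <• c ≠ 0) (h : toLin g (p <• c) = (p <• c) <• m) : m = l := by
  have hp : p ≠ 0 := by rintro rfl; simp at h0
  have hc : c ≠ 0 := by rintro rfl; simp at h0
  rw [toLin_right, hl, ← smul_right_mul, ← smul_right_mul] at h
  have h1 := smul_right_inj hp h
  rw [eq_coe_of_star_eq hs, Quaternion.coe_commutes] at h1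
  rw [eq_coe_of_star_eq hs]
  exact (mul_left_cancel₀ hc h1).symm

/-! ### Evenness -/

theorem exists_unit_quaternion {t : ℝ} (ht : t ^ 2 < 1) :
    ∃ l : ℍ[ℝ], l.re = t ∧ l.normSq = 1 ∧ star l ≠ l := by
  have h0 : 0 < 1 - t ^ 2 := by linarith
  obtain ⟨l, h1, h2, h3, h4⟩ : ∃ l : ℍ[ℝ],
      l.re = t ∧ l.imI = Real.sqrt (1 - t ^ 2) ∧ l.imJ = 0 ∧ l.imK = 0 :=
    ⟨⟨t, Real.sqrt (1 - t ^ 2), 0, 0⟩, rfl, rfl, rfl, rfl⟩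
  refine ⟨l, h1, ?_, fun h => ?_⟩
  · rw [Quaternion.normSq_def', h1, h2, h3, h4, Real.sq_sqrt h0.le]; ring
  · have := congrArg (fun q : ℍ[ℝ] => q.imI) h
    simp only [Quaternion.imI_star, h2] at this
    have := Real.sqrt_pos.mpr h0
    linarith

/-- Converts the condition on classes into the form required by `exists_reverses`: a nonreal class
of norm one is determined by its real part `t`, and inside a positive definite subspace it is of
positive type. -/
theorem PositiveClassCondition.even_finrank {g : Sp n} (h : PositiveClassCondition g)
    {W : Submodule ℍ[ℝ]ᵐᵒᵖ (V n)} (hpos : ∀ w ∈ W, w ≠ 0 → 0 < (Phi w w).re) {t : ℝ}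
    (ht : t ^ 2 < 1) (hle : quadSpace g t 1 ≤ W) :
    Even (Module.finrank ℍ[ℝ]ᵐᵒᵖ ↥(quadSpace g t 1 ⊓ W)) := by
  rw [inf_eq_left.mpr hle]
  by_cases hbot : quadSpace g t 1 = ⊥
  · rw [hbot, finrank_bot]; exact Even.zero
  obtain ⟨l, rfl, hN, hs⟩ := exists_unit_quaternion ht
  obtain ⟨v, hv, hv0⟩ := Submodule.exists_mem_ne_zero_of_ne_bot hbot
  obtain ⟨e, -, he0, he⟩ := exists_eigen_of_mem_quadSpace hv0 (by rw [hN]; exact hv)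
    (fun u hu => toLin_mem_quadSpace hu) hv
  have hpt : IsPositiveType g l := ⟨⟨e, he0, he⟩, fun u hu => by
    have h1 := mem_quadSpace_of_eigen (isEigenvector_iff.mp hu).2
    rw [hN] at h1
    exact hpos u (hle h1) hu.1⟩
  rcases h l hpt with h1 | h1 | h1
  · simp [h1] at hs
  · simp [h1] at hs
  · rw [multiplicity, eigenspace_eq_quadSpace hs, hN] at h1
    exact h1

/-- If `Phi p` were nonzero on the space, `s` would be a real root of `x² - 2 t x + 1`, which has
none for `t² < 1`. This places the nonreal classes in the complement of a core on which `g` has real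
eigenvalues. -/
theorem Phi_quadSpace_of_mul {g : Sp n} {p : V n} {s t : ℝ} (ht : t ^ 2 < 1)
    (h : ∀ v ∈ quadSpace g t 1, Phi p (toLin g v) = s • Phi p v) :
    ∀ v ∈ quadSpace g t 1, Phi p v = 0 := by
  intro v hv
  have h1 := h _ (toLin_mem_quadSpace hv)
  rw [mem_quadSpace.mp hv, one_smul, Phi_sub_right, Phi_real_smul_right, h v hv] at h1
  have h2 : (s * s - 2 * t * s + 1) • Phi p v = 0 := by
    rw [add_smul, sub_smul, mul_smul, ← h1, one_smul, smul_smul]; abel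
  refine (smul_eq_zero.mp h2).resolve_left fun h3 => ?_
  nlinarith [sq_nonneg (s - t)]

theorem Phi_quadSpace_of_real_eigen {g : Sp n} {p : V n} {s t : ℝ} (ht : t ^ 2 < 1)
    (hp : toLin g p = s • p) : ∀ v ∈ quadSpace g t 1, Phi p v = 0 := by
  refine Phi_quadSpace_of_mul (s := s⁻¹) ht fun v _ => ?_
  rw [← smul_coe] at hp
  rw [Phi_toLin_right, toLin_inv_eigen hp, ← Quaternion.coe_inv, smul_coe, Phi_real_smul_left]

/-! ### Hyperbolic elements -/

/-- Rescale `q` to `q'` with eigenvalue `l` and `Phi p q' = 1`. For an imaginary `c ≠ 0` commuting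
with `l`, the vector `p + q' c` has norm `c + star c = 0` and eigenvalue `l`. Thus eigenvalues of
norm one contradict having just two boundary fixed points. -/
theorem exists_third_fixed {g : Sp n} {p q : V n} (hp : Phi p p = 0) (hq : Phi q q = 0)
    (hpq : Phi p q ≠ 0) {l m : ℍ[ℝ]} (hl : toLin g p = p <• l) (hm : toLin g q = q <• m)
    (hn : ‖l‖ = 1) : ∃ r, IsFixedNull g r ∧ Phi p r ≠ 0 ∧ Phi q r ≠ 0 := by
  obtain ⟨c, hc0, hcs, hcl⟩ : ∃ c : ℍ[ℝ], c ≠ 0 ∧ star c = -c ∧ l * c = c * l := by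
    by_cases hs : star l = l
    · obtain ⟨i, hi, his, hil⟩ := exists_conj_star l
      refine ⟨i, ?_, his, by rw [hil, hs]⟩
      rintro rfl; simp at hi
    · refine ⟨l - star l, sub_ne_zero.mpr (Ne.symm hs), by simp, ?_⟩
      rw [mul_sub, sub_mul, Quaternion.star_mul_self, Quaternion.self_mul_star]
  set d := Phi p q with hd
  have h1 : d * m = l * d := by
    have h2 := Phi_eigen hl hm
    rw [← hd, mul_assoc] at h2
    calc d * m = l * (star l * (d * m)) := by
          rw [← mul_assoc l, mul_star_self_of_norm hn, one_mul]
      _ = l * d := by rw [h2]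
  set q' := q <• d⁻¹ with hq'
  have hq'g : toLin g q' = q' <• l := by
    refine toLin_eigen_smul hm _ ?_
    rw [← mul_left_inj' hpq, mul_assoc, mul_assoc, inv_mul_cancel₀ hpq, ← h1, ← mul_assoc,
      inv_mul_cancel₀ hpq]
    simp
  have hpq' : Phi p q' = 1 := by rw [hq', Phi_smul_right, ← hd, mul_inv_cancel₀ hpq]
  have hq'p : Phi q' p = 1 := by rw [← star_Phi, hpq', star_one]
  have hq'q' : Phi q' q' = 0 := by rw [hq', Phi_smul_left, Phi_smul_right, hq]; simp
  have hpr : Phi p (p + q' <• c) = c := by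
    rw [Phi_add_right, hp, Phi_smul_right, hpq', zero_add, one_mul]
  have hqr : Phi q' (p + q' <• c) = 1 := by
    rw [Phi_add_right, Phi_smul_right, hq'q', hq'p, zero_mul, add_zero]
  refine ⟨p + q' <• c, ⟨?_, ?_, l, ?_⟩, by rwa [hpr], fun h0 => ?_⟩
  · intro h0; rw [h0, Phi_zero_right] at hpr; exact hc0 hpr.symm
  · rw [Phi_add_left, hpr, Phi_smul_left, hqr, hcs, mul_one, add_neg_cancel]
  · rw [map_add, hl, toLin_eigen_smul hq'g c hcl, smul_add]
  · rw [hq', Phi_smul_left, h0, mul_zero] at hqr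
    exact zero_ne_one hqr

theorem IsHyperbolic.null_real {g x : Sp n} (hg : IsHyperbolic g) (h : Reverses x g) {m : ℍ[ℝ]}
    (hm : IsNullEigenvalue g m) : ∃ r : ℝ, m = (r : ℍ[ℝ]) := by
  obtain ⟨p, q, hp, hq, hpq, hall⟩ := hg.exists_pair
  obtain ⟨hp0, hpp, l, hl⟩ := hp
  obtain ⟨hq0, hqq, k, hk⟩ := hq
  have key : star l = l ∧ star k = k := by
    have hreal : ∀ {a : ℍ[ℝ]}, a = 1 ∨ a = -1 → star a = a := by
      rintro a (rfl | rfl) <;> simp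
    -- Either `x` fixes both boundary points or it exchanges them; fixing `p` while sending `q` to
    -- the line of `p` contradicts `x² = 1`.
    rcases hall _ (h.isFixedNull ⟨hp0, hpp, l, hl⟩) with ⟨a, ha⟩ | ⟨c, hc⟩
    · refine ⟨hreal (h.eigenvalue_of_fixed hp0 hl ha).2, ?_⟩
      rcases hall _ (h.isFixedNull ⟨hq0, hqq, k, hk⟩) with ⟨b, hb⟩ | ⟨b, hb⟩
      · exfalso
        have h1 := h.apply_apply q
        rw [hb, toLin_right, ha, ← smul_right_mul] at h1
        rw [← h1, Phi_smul_right, hpp, zero_mul] at hpq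
        exact hpq rfl
      · exact hreal (h.eigenvalue_of_fixed hq0 hk hb).2
    · refine ⟨h.star_eigenvalue_of_swap hpq hl hk hc, ?_⟩
      have hc0 : c ≠ 0 := by
        rintro rfl
        rw [MulOpposite.op_zero, zero_smul, toLin_eq_zero] at hc
        exact hp0 hc
      refine h.star_eigenvalue_of_swap (Phi_comm_ne_zero hpq) hk hl (c := c⁻¹) ?_
      have h1 := h.apply_apply p
      rw [hc, toLin_right] at h1
      rw [← h1, ← smul_right_mul, mul_inv_cancel₀ hc0, MulOpposite.op_one, one_smul]
  obtain ⟨e, he0, he, hee⟩ := hm.exists_null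
  rcases hall e ⟨he0, hee, m, he⟩ with ⟨c, rfl⟩ | ⟨c, rfl⟩
  · exact ⟨_, eq_coe_of_star_eq (eigenvalue_of_smul hl key.1 he0 he ▸ key.1)⟩
  · exact ⟨_, eq_coe_of_star_eq (eigenvalue_of_smul hk key.2 he0 he ▸ key.2)⟩

theorem IsHyperbolic.exists_reverses {g : Sp n} (hg : IsHyperbolic g)
    (hP : PositiveClassCondition g)
    (hnull : ∀ l, IsNullEigenvalue g l → ∃ r : ℝ, l = (r : ℍ[ℝ])) : ∃ x, Reverses x g := by
  obtain ⟨p, q, ⟨hp0, hpp, l, hl⟩, ⟨hq0, hqq, k, hk⟩, hpq, hall⟩ := hg.exists_pair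
  have hn : ‖l‖ ≠ 1 := by
    intro hn
    obtain ⟨r, hr, hpr, hqr⟩ := exists_third_fixed hpp hqq hpq hl hk hn
    rcases hall r hr with ⟨c, rfl⟩ | ⟨c, rfl⟩
    · rw [Phi_smul_right, hpp, zero_mul] at hpr; exact hpr rfl
    · rw [Phi_smul_right, hqq, zero_mul] at hqr; exact hqr rfl
  -- Since `|l|² ≠ 1`, `p` is orthogonal to every eigenvector for `l`, so `l` is null and the
  -- hypothesis applies to it.
  obtain ⟨r, rfl⟩ : ∃ r : ℝ, l = (r : ℍ[ℝ]) := by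
    refine hnull l ⟨p, mem_eigenspace_of_eigen hl, hp0, fun w hw =>
      orthogonal_eigenspace (fun e he => ?_) hw⟩
    have h1 := congrArg norm (Phi_eigen hl he)
    rw [norm_mul, norm_mul, norm_star] at h1
    by_contra h0
    have h2 : ‖Phi p e‖ ≠ 0 := norm_ne_zero_iff.mpr h0
    have h3 : ‖l‖ * ‖l‖ = 1 := mul_right_cancel₀ h2 (by linarith)
    exact hn (by nlinarith [norm_nonneg l])
  have hr0 : r ≠ 0 := by
    rintro rfl
    exact eigenvalue_ne_zero hp0 hl Quaternion.coe_zero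
  rw [smul_coe] at hl
  have hk' : toLin g q = r⁻¹ • q := by
    have h1 : Phi p (toLin g q - r⁻¹ • q) = 0 := by
      rw [← smul_coe] at hl
      rw [Phi_sub_right, Phi_toLin_right, toLin_inv_eigen hl, ← Quaternion.coe_inv, smul_coe,
        Phi_real_smul_left, Phi_real_smul_right, sub_self]
    rw [hk, ← smul_coe, ← sub_smul, ← MulOpposite.op_sub, Phi_smul_right] at h1
    have h2 := sub_eq_zero.mp ((mul_eq_zero.mp h1).resolve_left hpq)
    rw [hk, h2, smul_coe]
  -- With `Phi p q₁ = -1` the difference `p - q₁` has norm `2`, and its reflection exchanges `p` and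
  -- `q₁`, whose eigenvalues are `r` and `r⁻¹`.
  set q₁ := q <• (-(Phi p q)⁻¹) with hq₁
  have hq₁g : toLin g q₁ = r⁻¹ • q₁ := by rw [hq₁, toLin_right, hk', smul_comm]
  have hpq₁ : Phi p q₁ = -1 := by
    rw [hq₁, Phi_smul_right, mul_neg, mul_inv_cancel₀ hpq]
  have hq₁p : Phi q₁ p = -1 := by rw [← star_Phi, hpq₁, star_neg, star_one]
  have hq₁q₁ : Phi q₁ q₁ = 0 := by rw [hq₁, Phi_smul_left, Phi_smul_right, hqq]; simp
  set f := p - q₁ with hf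
  have hff : Phi f f = ((2 : ℝ) : ℍ[ℝ]) := by
    simp only [hf, Phi_sub_left, Phi_sub_right, hpp, hpq₁, hq₁p, hq₁q₁]
    rw [zero_sub, neg_neg, sub_zero, sub_neg_eq_add, coe_two]
  obtain ⟨R, hR, hRR⟩ := exists_reflection two_ne_zero hff
  have hR' : ∀ v, toLin R v = v - f <• Phi f v := by
    intro v; rw [hR, div_self two_ne_zero, one_smul]
  have hRp : toLin R p = q₁ := by
    rw [hR', hf, Phi_sub_left, hpp, hq₁p, zero_sub, neg_neg, MulOpposite.op_one, one_smul,
      sub_sub_cancel]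
  have hRq : toLin R q₁ = p := by
    rw [hR', hf, Phi_sub_left, hq₁q₁, hpq₁, sub_zero, MulOpposite.op_neg, MulOpposite.op_one,
      neg_smul, one_smul]
    abel
  have hpos : ∀ w ∈ perp p ⊓ perp q₁, w ≠ 0 → 0 < (Phi w w).re := by
    intro w hw hw0
    refine pos_of_orthogonal_neg (v := p + q₁) ?_ ?_ hw0
    · simp only [Phi_add_left, Phi_add_right, hpp, hpq₁, hq₁p, hq₁q₁]
      simp
    · rw [Phi_add_left, mem_perp.mp hw.1, mem_perp.mp hw.2, add_zero]
  refine QuatHyp.exists_reverses _ (perp p ⊓ perp q₁) R rfl hRR hpos (fun w hw => ?_)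
    (fun w hw => ?_) (fun v hv => ?_) (fun t ht => hP.even_finrank hpos ht fun v hv => ?_)
  · rw [← smul_coe] at hl hq₁g
    exact ⟨toLin_mem_perp hl hw.1, toLin_mem_perp hq₁g hw.2⟩
  · rw [hR', hf, Phi_sub_left, mem_perp.mp hw.1, mem_perp.mp hw.2, sub_zero, MulOpposite.op_zero,
      zero_smul, sub_zero]
  -- `u` is `v` minus its projection to the hyperbolic plane. Since `v` is orthogonal to the
  -- complement, `u` is null there, hence zero, and `v` lies in the plane.
  · set u := v + p <• Phi q₁ v + q₁ <• Phi p v with hu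
    have hpu : Phi p u = 0 := by
      rw [hu, Phi_add_right, Phi_add_right, Phi_smul_right, Phi_smul_right, hpp, hpq₁]
      simp
    have hqu : Phi q₁ u = 0 := by
      rw [hu, Phi_add_right, Phi_add_right, Phi_smul_right, Phi_smul_right, hq₁p, hq₁q₁]
      simp
    have hu0 : u = 0 := by
      by_contra h0
      have h1 := hpos u ⟨hpu, hqu⟩ h0
      have h2 : Phi u u = 0 := by
        conv_lhs => rhs; rw [hu]
        rw [Phi_add_right, Phi_add_right, Phi_smul_right, Phi_smul_right, Phi_comm_eq_zero hpu,
          Phi_comm_eq_zero hqu, hv u ⟨hpu, hqu⟩]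
        simp
      rw [h2] at h1
      simp at h1
    have hv' : v = -(p <• Phi q₁ v) - q₁ <• Phi p v := by
      rw [hu] at hu0
      rw [eq_sub_iff_add_eq, eq_neg_iff_add_eq_zero, ← hu0]; abel
    rw [hv']
    simp only [map_sub, map_neg, toLin_right, hl, toLin_real, hRp, hRq, hq₁g, smul_smul,
      mul_inv_cancel₀ hr0, inv_mul_cancel₀ hr0, one_smul]
  · exact ⟨Phi_quadSpace_of_real_eigen ht hl v hv, Phi_quadSpace_of_real_eigen ht hq₁g v hv⟩

/-! ### Elliptic elements -/

theorem ne_zero_of_neg {v : V n} (h : (Phi v v).re < 0) : v ≠ 0 := by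
  rintro rfl; rw [Phi_zero_left] at h; simp at h

/-- The coefficient `T • Phi p v` makes the cross term real, so the norm is affine in `T`. When `Phi
p v ≠ 0`, every real value is attained. -/
theorem re_Phi_add_null {v p : V n} (hpp : Phi p p = 0) (T : ℝ) :
    (Phi (v + p <• (T • Phi p v)) (v + p <• (T • Phi p v))).re =
      (Phi v v).re + 2 * T * (Phi p v).normSq := by
  simp only [Phi_add_left, Phi_add_right, Phi_smul_left, Phi_smul_right, hpp,
    add_zero, mul_zero, mul_smul_comm, smul_mul_assoc, Quaternion.star_smul]
  rw [← star_Phi p v, Quaternion.star_mul_self]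
  simp
  ring

/-- Otherwise `x v` would be orthogonal to the negative vector `v`, hence positive, although it has
the same norm as `v`. -/
theorem IsElliptic.reverses_eigen {g x : Sp n} (h : Reverses x g) {v : V n} {l : ℍ[ℝ]}
    (hv : (Phi v v).re < 0) (hl : toLin g v = v <• l) : l = 1 ∨ l = -1 := by
  refine (h.Phi_orthogonal (norm_eigenvalue hl hv.ne) hl).resolve_left fun h0 => ?_
  have h1 := pos_of_orthogonal_neg hv h0 (fun h2 => ne_zero_of_neg hv (toLin_eq_zero.mp h2))
  rw [Phi_toLin] at h1
  linarith

/-- The eigenvalues of negative or indefinite type. -/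
theorem exists_neg_of_type {g : Sp n} {l : ℍ[ℝ]} (h : IsNegativeType g l ∨ IsIndefiniteType g l) :
    ∃ w ∈ eigenspace g l, (Phi w w).re < 0 := by
  rcases h with ⟨⟨w, hw⟩, h⟩ | ⟨-, h⟩
  · exact ⟨w, mem_eigenspace_of_eigen hw.2, h w hw⟩
  · exact h

theorem negative_or_indefinite_eq {g : Sp n} {v : V n} {l : ℍ[ℝ]} (hv : (Phi v v).re < 0)
    (hl : toLin g v = v <• l) (hl1 : l = 1 ∨ l = -1) :
    {m | IsNegativeType g m ∨ IsIndefiniteType g m} = {l} := by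
  have hs : star l = l := by rcases hl1 with rfl | rfl <;> simp
  have hll : l * l = 1 := mul_self_eq_one_iff.mpr hl1
  have hv0 := ne_zero_of_neg hv
  refine Set.eq_singleton_iff_unique_mem.mpr ⟨?_, fun m hm => ?_⟩
  · by_cases h : ∃ u ∈ eigenspace g l, 0 < (Phi u u).re
    · exact Or.inr ⟨h, v, mem_eigenspace_of_eigen hl, hv⟩
    · refine Or.inl ⟨⟨v, hv0, hl⟩, fun p hp => ?_⟩
      push Not at h
      refine lt_of_le_of_ne (h p (mem_eigenspace_of_eigen hp.2)) fun h0 => ?_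
      have hpp := Phi_self_eq_zero h0
      have hpv : Phi p v ≠ 0 := fun hpv => by
        have := pos_of_orthogonal_neg hv (Phi_comm_eq_zero hpv) hp.1
        linarith
      have hd : 0 < (Phi p v).normSq := by
        rw [Quaternion.normSq_eq_norm_mul_self]; positivity
      -- A null eigenvector `p` would pair nontrivially with `v`; this multiple of it changes the
      -- norm of `v` to its opposite, giving a positive vector in the eigenspace.
      have h1 := h (v + p <• (((-(Phi v v).re) / (Phi p v).normSq) • Phi p v))
        (add_mem (mem_eigenspace_of_eigen hl)
          (Submodule.smul_mem _ _ (mem_eigenspace_of_eigen hp.2)))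
      rw [re_Phi_add_null hpp] at h1
      have h2 : 2 * (-(Phi v v).re / (Phi p v).normSq) * (Phi p v).normSq = -2 * (Phi v v).re := by
        field_simp
      rw [h2] at h1
      linarith
  · obtain ⟨w, hw, hneg⟩ := exists_neg_of_type hm
    by_contra hne
    -- A different eigenvalue `m` would yield a negative vector orthogonal to `v`, contradicting the
    -- signature.
    have h0 : Phi v w = 0 := by
      refine orthogonal_eigenspace (fun e he => ?_) hw
      have h1 := Phi_eigen hl he
      rw [hs] at h1
      by_contra hc
      have h2 : Phi v e * m = Phi v e * l := by
        calc Phi v e * m = l * (l * Phi v e * m) := by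
              rw [← mul_assoc, ← mul_assoc, hll, one_mul]
          _ = l * Phi v e := by rw [h1]
          _ = Phi v e * l := by rw [eq_coe_of_star_eq hs, Quaternion.coe_commutes]
      exact hne (mul_left_cancel₀ hc h2)
    have := pos_of_orthogonal_neg hv h0 (ne_zero_of_neg hneg)
    linarith

theorem isElliptic_reversible_iff {g : Sp n} (hg : IsElliptic g) :
    StronglyReversible g ↔
      ({l | IsNegativeType g l ∨ IsIndefiniteType g l} = {1} ∨
        {l | IsNegativeType g l ∨ IsIndefiniteType g l} = {-1}) ∧ PositiveClassCondition g := by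
  rw [stronglyReversible_iff]
  constructor
  · rintro ⟨x, hx⟩
    refine ⟨?_, hx.positiveClassCondition⟩
    obtain ⟨v, l, hv, hl⟩ := isElliptic_iff.mp hg
    rcases IsElliptic.reverses_eigen hx hv hl with rfl | rfl
    · exact Or.inl (negative_or_indefinite_eq hv hl (Or.inl rfl))
    · exact Or.inr (negative_or_indefinite_eq hv hl (Or.inr rfl))
  · rintro ⟨hset, hP⟩
    obtain ⟨s, hs, v, hv, hl⟩ : ∃ s : ℝ, s * s = 1 ∧ ∃ v, (Phi v v).re < 0 ∧
        toLin g v = s • v := by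
      rcases hset with h | h
      · obtain ⟨v, hv, hneg⟩ := exists_neg_of_type (h ▸ Set.mem_singleton (1 : ℍ[ℝ]))
        refine ⟨1, by norm_num, v, hneg, ?_⟩
        rw [(mem_eigenspace_of_star_eq (by simp)).mp hv, MulOpposite.op_one, one_smul, one_smul]
      · obtain ⟨v, hv, hneg⟩ := exists_neg_of_type (h ▸ Set.mem_singleton (-1 : ℍ[ℝ]))
        refine ⟨-1, by norm_num, v, hneg, ?_⟩
        rw [(mem_eigenspace_of_star_eq (by simp)).mp hv, MulOpposite.op_neg, MulOpposite.op_one,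
          neg_smul, neg_smul, one_smul, one_smul]
    have hpos : ∀ w ∈ perp v, w ≠ 0 → 0 < (Phi w w).re := fun w hw =>
      pos_of_orthogonal_neg hv hw
    -- The core is the line of `v`, where `g = ±1`, so the identity serves as initial involution.
    refine exists_reverses _ (perp v) 1 rfl (one_mul 1) hpos
      (fun w hw => toLin_mem_perp (by rw [hl, smul_coe]) hw) (fun w _ => toLin_one w)
      (fun u hu => ?_)
      (fun t ht => hP.even_finrank hpos ht (Phi_quadSpace_of_real_eigen ht hl))
    set r := (Phi v v).re with hr
    have hvv : Phi v v = (r : ℍ[ℝ]) := Phi_self v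
    have hr0 : (r : ℍ[ℝ]) ≠ 0 := fun h0 => hv.ne (Quaternion.coe_injective (by simpa using h0))
    set w := u - v <• ((r : ℍ[ℝ])⁻¹ * Phi v u) with hw
    have hvw : Phi v w = 0 := by
      rw [hw, Phi_sub_right, Phi_smul_right, hvv, ← mul_assoc, mul_inv_cancel₀ hr0, one_mul,
        sub_self]
    have hw0 : w = 0 := by
      by_contra h0
      have h1 := hpos w hvw h0
      have h2 : Phi w w = 0 := by
        conv_lhs => rhs; rw [hw]
        rw [Phi_sub_right, Phi_smul_right, Phi_comm_eq_zero hvw, hu w hvw]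
        simp
      rw [h2] at h1
      simp at h1
    rw [hw, sub_eq_zero] at hw0
    rw [hw0]
    simp only [toLin_one, toLin_right, hl, toLin_real]
    rw [smul_smul, hs, one_smul]

theorem isHyperbolic_reversible_iff {g : Sp n} (hg : IsHyperbolic g) :
    StronglyReversible g ↔
      PositiveClassCondition g ∧ ∀ l, IsNullEigenvalue g l → ∃ r : ℝ, l = (r : ℍ[ℝ]) := by
  rw [stronglyReversible_iff]
  exact ⟨fun ⟨_, hx⟩ => ⟨hx.positiveClassCondition, fun _ hl => hg.null_real hx hl⟩,
    fun h => hg.exists_reverses h.1 h.2⟩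

/-! ### Unipotent elements -/

/-- The linear map `u - 1`. -/
noncomputable def subOne (u : Sp n) : Module.End ℍ[ℝ]ᵐᵒᵖ (V n) := toLin u - 1

theorem subOne_apply (u : Sp n) (v : V n) : subOne u v = toLin u v - v := rfl

theorem toLin_eq_add_subOne (u : Sp n) (v : V n) : toLin u v = v + subOne u v := by
  rw [subOne_apply, add_sub_cancel]

theorem subOne_pow_apply (u : Sp n) (k : ℕ) (v : V n) :
    (subOne u ^ k) v = ((mat u - 1) ^ k) *ᵥ v := by
  induction k generalizing v with
  | zero => simp
  | succ k ih =>
    rw [pow_succ, pow_succ, Module.End.mul_apply, ih, ← Matrix.mulVec_mulVec, subOne_apply,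
      Matrix.sub_mulVec, Matrix.one_mulVec]
    rfl

theorem subOne_pow_eq_zero_iff (u : Sp n) (k : ℕ) : subOne u ^ k = 0 ↔ (mat u - 1) ^ k = 0 := by
  constructor
  · intro h
    refine mulVec_ext fun v => ?_
    rw [← subOne_pow_apply, h, Matrix.zero_mulVec]; rfl
  · intro h
    refine LinearMap.ext fun v => ?_
    rw [subOne_pow_apply, h, Matrix.zero_mulVec]; rfl

theorem Phi_subOne (u : Sp n) (v w : V n) :
    Phi (subOne u v) w = -Phi (toLin u v) (subOne u w) := by
  rw [subOne_apply, subOne_apply, Phi_sub_left, Phi_sub_right, Phi_toLin]; abel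

theorem toLin_subOne_pow (u : Sp n) (k : ℕ) (v : V n) :
    toLin u ((subOne u ^ k) v) = (subOne u ^ k) (toLin u v) := by
  have h : Commute (toLin u : Module.End ℍ[ℝ]ᵐᵒᵖ (V n)) (subOne u ^ k) :=
    ((Commute.refl _).sub_right (Commute.one_right _)).pow_right k
  exact congrArg (fun f : Module.End ℍ[ℝ]ᵐᵒᵖ (V n) => f v) h.eq

/-- Each transfer of a factor `u - 1` across the form costs a sign and a factor `u`, which commutes
with the powers; after `a` transfers the vanishing power appears. -/
theorem Phi_subOne_pow {u : Sp n} (a : ℕ) : ∀ (b : ℕ), subOne u ^ (a + b) = 0 →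
    ∀ v w : V n, Phi ((subOne u ^ a) v) ((subOne u ^ b) w) = 0 := by
  induction a with
  | zero =>
    intro b h v w
    rw [zero_add] at h
    rw [h, LinearMap.zero_apply, Phi_zero_right]
  | succ a ih =>
    intro b h v w
    have hb : subOne u ((subOne u ^ b) w) = (subOne u ^ (b + 1)) w := by
      rw [pow_succ', Module.End.mul_apply]
    rw [pow_succ', Module.End.mul_apply, Phi_subOne, toLin_subOne_pow, hb, ih (b + 1) (by rw [← h]; congr 1; omega), neg_zero]

/-- Unipotent elements satisfy `(u - 1)³ = 0`. -/
theorem IsUnipotent.subOne_cube {u : Sp n} (hu : IsUnipotent u) : subOne u ^ 3 = 0 := by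
  have hnil : ∃ k, subOne u ^ k = 0 := by
    obtain ⟨k, hk⟩ := hu
    exact ⟨k, (subOne_pow_eq_zero_iff u k).mpr hk⟩
  classical
  set k := Nat.find hnil with hk
  have hk0 : subOne u ^ k = 0 := Nat.find_spec hnil
  have hle : ∀ m, k ≤ m → subOne u ^ m = 0 := fun m hm => pow_eq_zero_of_le hm hk0
  by_contra h3
  -- For nilpotency index `k ≥ 4` one has `2 (k - 2) ≥ k`, so with `N = u - 1` the vectors `N^(k-1)
  -- v` and `N^(k-2) v` are null and orthogonal, hence proportional; applying `N` gives `N^(k-1) v =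
  -- 0`.
  have hk4 : 4 ≤ k := by
    by_contra hlt
    exact h3 (hle 3 (by omega))
  have hk1 : subOne u ^ (k - 1) ≠ 0 := Nat.find_min hnil (by omega)
  obtain ⟨v, hv⟩ : ∃ v, (subOne u ^ (k - 1)) v ≠ 0 := by
    by_contra hcon
    push Not at hcon
    exact hk1 (LinearMap.ext hcon)
  obtain ⟨c, hc⟩ := exists_eq_smul_of_null hv
    (Phi_subOne_pow _ _ (hle _ (by omega)) v v)
    (Phi_subOne_pow (k - 2) (k - 2) (hle _ (by omega)) v v)
    (Phi_subOne_pow _ _ (hle _ (by omega)) v v)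
  have h1 := congrArg (subOne u) hc
  rw [← Module.End.mul_apply, ← pow_succ', map_smul, ← Module.End.mul_apply, ← pow_succ',
    hle (k - 1 + 1) (by omega), show k - 2 + 1 = k - 1 by omega, LinearMap.zero_apply,
    smul_zero] at h1
  exact hv h1

theorem IsUnipotent.eigenvalue_eq_one {u : Sp n} (hu : IsUnipotent u) {v : V n} (hv : v ≠ 0)
    {a : ℍ[ℝ]} (h : toLin u v = v <• a) : a = 1 := by
  have h1 : subOne u v = v <• (a - 1) := by
    rw [subOne_apply, h, MulOpposite.op_sub, sub_smul, MulOpposite.op_one, one_smul]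
  have h2 := congrArg (fun f : Module.End ℍ[ℝ]ᵐᵒᵖ (V n) => f v) hu.subOne_cube
  simp only [pow_succ, pow_zero, one_mul, Module.End.mul_apply, h1, map_smul,
    LinearMap.zero_apply] at h2
  rw [smul_right_eq_zero, smul_right_eq_zero, smul_right_eq_zero] at h2
  have h3 : a - 1 = 0 := by tauto
  exact sub_eq_zero.mp h3

theorem minimalPolynomial_cube_iff (u : Sp n) :
    minimalPolynomial u = (Polynomial.X - 1) ^ 3 ↔ subOne u ^ 3 = 0 ∧ subOne u ^ 2 ≠ 0 := by
  rw [subOne_pow_eq_zero_iff, Ne, subOne_pow_eq_zero_iff, minimalPolynomial]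
  have haev : ∀ k : ℕ, Polynomial.aeval (mat u) ((Polynomial.X - 1 : Polynomial ℝ) ^ k) =
      (mat u - 1) ^ k := fun k => by simp
  have hmon : ∀ k : ℕ, ((Polynomial.X - 1 : Polynomial ℝ) ^ k).Monic := fun k => by
    simpa using (Polynomial.monic_X_sub_C (1 : ℝ)).pow k
  have hdeg : ∀ k : ℕ, ((Polynomial.X - 1 : Polynomial ℝ) ^ k).natDegree = k := fun k => by
    have := Polynomial.natDegree_X_sub_C (1 : ℝ)
    rw [Polynomial.natDegree_pow, ← Polynomial.C_1, this, mul_one]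
  constructor
  · intro h
    refine ⟨?_, fun h2 => ?_⟩
    · rw [← haev, ← h, minpoly.aeval]
    · have h3 := Polynomial.natDegree_le_of_dvd
        (minpoly.dvd ℝ (mat u) ((haev 2).trans h2)) (hmon 2).ne_zero
      rw [h, hdeg, hdeg] at h3
      omega
  · rintro ⟨h3, h2⟩
    have hdvd := minpoly.dvd ℝ (mat u) ((haev 3).trans h3)
    have hprime : Prime (Polynomial.X - 1 : Polynomial ℝ) := by
      simpa using Polynomial.prime_X_sub_C (1 : ℝ)
    obtain ⟨i, hi, hassoc⟩ := (dvd_prime_pow hprime 3).mp hdvd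
    have hint : IsIntegral ℝ (mat u) :=
      ⟨_, hmon 3, by rw [← Polynomial.aeval_def, haev, h3]⟩
    have heq := Polynomial.eq_of_monic_of_associated (minpoly.monic hint) (hmon i) hassoc
    have hz : (mat u - 1) ^ i = 0 := by rw [← haev, ← heq, minpoly.aeval]
    have : i = 3 := by
      by_contra hne
      exact h2 (pow_eq_zero_of_le (by omega) hz)
    rw [heq, this]

/-! ### Parabolic elements -/

/-- `p` spans the unique fixed point of `g` on the boundary. -/
def IsUniqueNull (g : Sp n) (p : V n) : Prop :=
  IsFixedNull g p ∧ ∀ q, IsFixedNull g q → ∃ c : ℍ[ℝ], q = p <• c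

/-- If `Phi p w ≠ 0`, adding a suitable multiple of `p` to `w` gives a null eigenvector not
proportional to `p`, a second fixed point. -/
theorem IsUniqueNull.orthogonal {g : Sp n} {p : V n} (h : IsUniqueNull g p) {l : ℍ[ℝ]}
    (hl : toLin g p = p <• l) (hs : star l = l) {w : V n} (hw : toLin g w = w <• l) :
    Phi p w = 0 := by
  by_contra hne
  have hpp := h.1.2.1
  set T : ℝ := -(Phi w w).re / (2 * (Phi p w).normSq) with hT
  have hd : (Phi p w).normSq ≠ 0 := Quaternion.normSq_ne_zero.mpr hne
  have hp : Phi p (w + p <• (T • Phi p w)) = Phi p w := by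
    rw [Phi_add_right, Phi_smul_right, hpp, zero_mul, add_zero]
  have hfix : IsFixedNull g (w + p <• (T • Phi p w)) := by
    refine ⟨fun h0 => ?_, Phi_self_eq_zero ?_, l, ?_⟩
    · rw [h0, Phi_zero_right] at hp
      exact hne hp.symm
    · rw [re_Phi_add_null hpp, hT]
      field_simp
      ring
    · have hcomm : l * (T • Phi p w) = (T • Phi p w) * l := by
        rw [eq_coe_of_star_eq hs, Quaternion.coe_commutes]
      rw [map_add, hw, toLin_eigen_smul hl _ hcomm, smul_add]
  obtain ⟨c, hc⟩ := h.2 _ hfix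
  rw [hc, Phi_smul_right, hpp, zero_mul] at hp
  exact hne hp.symm

theorem IsUniqueNull.null_eigenvalues {g : Sp n} {p : V n} (h : IsUniqueNull g p) {l : ℍ[ℝ]}
    (hl : toLin g p = p <• l) (hs : star l = l) : {m | IsNullEigenvalue g m} = {l} := by
  refine Set.eq_singleton_iff_unique_mem.mpr ⟨?_, fun m hm => ?_⟩
  · exact ⟨p, mem_eigenspace_of_eigen hl, h.1.1, fun w hw =>
      h.orthogonal hl hs ((mem_eigenspace_of_star_eq hs).mp hw)⟩
  · obtain ⟨e, he0, he, hee⟩ := IsNullEigenvalue.exists_null hm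
    obtain ⟨c, rfl⟩ := h.2 e ⟨he0, hee, m, he⟩
    exact eigenvalue_of_smul hl hs he0 he

theorem IsUniqueNull.eigen_of_null {g : Sp n} {p : V n} (h : IsUniqueNull g p) {s : ℝ}
    (hs : IsNullEigenvalue g (s : ℍ[ℝ])) : toLin g p = s • p := by
  obtain ⟨e, he0, he, hee⟩ := hs.exists_null
  obtain ⟨c, rfl⟩ := h.2 e ⟨he0, hee, _, he⟩
  have hc : c ≠ 0 := by rintro rfl; simp at he0
  rw [smul_coe, toLin_right, smul_comm] at he
  have h1 := congrArg (fun v : V n => v <• c⁻¹) he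
  simpa only [← smul_right_mul, smul_comm _ s, mul_inv_cancel₀ hc, MulOpposite.op_one,
    one_smul] using h1

/-- Elements commuting with `g` fix its unique boundary fixed point. -/
theorem IsUniqueNull.commute {g h : Sp n} {p : V n} (hp : IsUniqueNull g p) (hc : Commute h g) :
    ∃ a : ℍ[ℝ], toLin h p = p <• a := by
  obtain ⟨hp0, hpp, l, hl⟩ := hp.1
  refine hp.2 _ ⟨fun h0 => hp0 (toLin_eq_zero.mp h0), by rw [Phi_toLin, hpp], l, ?_⟩
  rw [← toLin_mul, ← hc.eq, toLin_mul, hl, toLin_right]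

theorem Phi_ne_zero_of_neg {p v : V n} (hp : p ≠ 0) (hpp : Phi p p = 0)
    (hv : (Phi v v).re < 0) : Phi p v ≠ 0 := by
  intro h0
  have := pos_of_orthogonal_neg hv (Phi_comm_eq_zero h0) hp
  rw [hpp] at this
  simp at this

/-- The action of the Jordan components at the boundary fixed point, and a negative
eigenvector of the elliptic component. -/
theorem IsUniqueNull.jordan {g gs gu : Sp n} {p : V n} (hp : IsUniqueNull g p)
    (hJ : IsJordanDecomposition g gs gu) {s : ℝ} (hs : s * s = 1) (hl : toLin g p = s • p) :
    toLin gu p = p ∧ toLin gs p = s • p ∧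
      ∃ v, (Phi v v).re < 0 ∧ toLin gs v = s • v ∧ Phi p v ≠ 0 := by
  obtain ⟨rfl, hcomm, hell, huni⟩ := hJ
  have hp0 := hp.1.1
  have hup : toLin gu p = p := by
    obtain ⟨b, hb⟩ := hp.commute (h := gu) (hcomm.symm.mul_right (Commute.refl gu))
    have hb1 := huni.eigenvalue_eq_one hp0 hb
    rw [hb, hb1, MulOpposite.op_one, one_smul]
  have hsp : toLin gs p = s • p := by rw [← hl, toLin_mul, hup]
  refine ⟨hup, hsp, ?_⟩
  obtain ⟨v, m, hv, hm⟩ := isElliptic_iff.mp hell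
  have hpv := Phi_ne_zero_of_neg hp0 hp.1.2.1 hv
  refine ⟨v, hv, ?_, hpv⟩
  rw [← smul_coe] at hsp
  -- Since `Phi p v ≠ 0`, invariance under `gs` forces `m = s⁻¹ = s`.
  have h1 := Phi_eigen hsp hm
  rw [Quaternion.star_coe, Quaternion.coe_commutes, mul_assoc] at h1
  have h2 : (s : ℍ[ℝ]) * m = 1 := mul_left_cancel₀ hpv (by rw [h1, mul_one])
  have h3 : m = (s : ℍ[ℝ]) := by
    have h4 : (s : ℍ[ℝ]) * s = 1 := by rw [← Quaternion.coe_mul, hs, Quaternion.coe_one]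
    calc m = (s * s : ℍ[ℝ]) * m := by rw [h4, one_mul]
      _ = s := by rw [mul_assoc, h2, mul_one]
  rw [hm, h3, smul_coe]

/-- As `g⁻¹` translates `v` by `-p d`, the vector `z = x v - ε v` is orthogonal to `p` and satisfies
`g z = s (z - 2 ε p d)`. Invariance of `Phi z v` then gives `2 ε (star d) (Phi p v) = 0`. -/
theorem Reverses.not_translation {x g : Sp n} (h : Reverses x g) {p v : V n} {s ε : ℝ}
    (hs : s * s = 1) (hε : ε * ε = 1) (hpp : Phi p p = 0) (hgp : toLin g p = s • p)
    (hxp : toLin x p = ε • p) {d : ℍ[ℝ]} (hd : d ≠ 0) (hpv : Phi p v ≠ 0)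
    (hgv : toLin g v = s • (v + p <• d)) : False := by
  have hgp' : toLin g⁻¹ p = s • p := by
    have h1 := congrArg (fun w => s • toLin g⁻¹ w) hgp
    simp only [toLin_inv_apply, toLin_real, smul_smul, hs, one_smul] at h1
    exact h1.symm
  have hgv' : toLin g⁻¹ v = s • (v - p <• d) := by
    have h1 := congrArg (fun w => s • toLin g⁻¹ w) hgv
    simp only [toLin_inv_apply, toLin_real, map_add, toLin_right, hgp', smul_smul, hs,
      one_smul] at h1
    rw [smul_sub, h1, smul_comm s (MulOpposite.op d) p]
    abel
  set z := toLin x v - ε • v with hz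
  have hgz : toLin g z = s • (z - (2 * ε) • (p <• d)) := by
    rw [hz, map_sub, h.comm, hgv', toLin_real, toLin_real, hgv, map_sub, toLin_right, hxp,
      smul_comm (MulOpposite.op d) ε p]
    generalize MulOpposite.op d • p = q
    module
  have hpz : Phi p z = 0 := by
    rw [hz, Phi_sub_right, ← h.Phi_symm, hxp, Phi_real_smul_left, Phi_real_smul_right, sub_self]
  have h1 := Phi_toLin g z v
  rw [hgz, hgv, Phi_real_smul_left, Phi_real_smul_right, smul_smul, hs, one_smul, Phi_sub_left,
    Phi_add_right, Phi_add_right, Phi_smul_right, Phi_comm_eq_zero hpz, Phi_real_smul_left,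
    Phi_real_smul_left, Phi_smul_left, Phi_smul_left, Phi_smul_right, hpp] at h1
  simp only [zero_mul, mul_zero, smul_zero, add_zero, sub_eq_self] at h1
  have h2 : 2 * ε ≠ 0 := by
    intro h0
    have : ε = 0 := by linarith
    rw [this] at hε
    norm_num at hε
  rcases smul_eq_zero.mp h1 with h3 | h3
  · exact h2 h3
  · exact (mul_ne_zero (star_ne_zero.mpr hd) hpv) h3

theorem exists_real_of_sq {l : ℍ[ℝ]} (h : l = 1 ∨ l = -1) :
    ∃ s : ℝ, s * s = 1 ∧ l = (s : ℍ[ℝ]) := by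
  rcases h with rfl | rfl
  · exact ⟨1, by norm_num, by simp⟩
  · exact ⟨-1, by norm_num, by simp⟩

theorem IsUniqueNull.of_reverses {x g gs gu : Sp n} {p : V n} (hp : IsUniqueNull g p)
    (h : Reverses x g) (hJ : IsJordanDecomposition g gs gu) :
    ({l | IsNullEigenvalue g l} = {1} ∨ {l | IsNullEigenvalue g l} = {-1}) ∧
      minimalPolynomial gu = (Polynomial.X - 1) ^ 3 := by
  obtain ⟨hp0, hpp, l, hl⟩ := hp.1
  obtain ⟨a, ha⟩ := hp.2 _ (h.isFixedNull hp.1)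
  obtain ⟨ha1, hl1⟩ := h.eigenvalue_of_fixed hp0 hl ha
  refine ⟨?_, (minimalPolynomial_cube_iff gu).mpr ⟨hJ.2.2.2.subOne_cube, fun h2 => ?_⟩⟩
  · rcases hl1 with rfl | rfl
    · exact Or.inl (hp.null_eigenvalues hl (by simp))
    · exact Or.inr (hp.null_eigenvalues hl (by simp))
  · obtain ⟨s, hs, rfl⟩ := exists_real_of_sq hl1
    obtain ⟨ε, hε, rfl⟩ := exists_real_of_sq ha1
    rw [smul_coe] at hl ha
    obtain ⟨-, -, v, hv, hsv, hpv⟩ := hp.jordan hJ hs hl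
    obtain ⟨hg, hcomm, -, -⟩ := hJ
    -- With `N = gu - 1` and `N² = 0`: if `N v = 0`, then `v` is an eigenvector not orthogonal to
    -- `p`, which is excluded; otherwise `N v` is a null eigenvector, so `N v = p d` and `g` is a
    -- translation on `v`.
    have hgv : toLin g v = s • (v + subOne gu v) := by
      rw [hg, hcomm.eq, toLin_mul, hsv, toLin_real, toLin_eq_add_subOne]
    have hN : subOne gu (subOne gu v) = 0 := by
      rw [← Module.End.mul_apply, ← sq, h2, LinearMap.zero_apply]
    have hgN : toLin g (subOne gu v) = s • subOne gu v := by
      rw [hg, toLin_mul, toLin_eq_add_subOne gu, hN, add_zero, subOne_apply, map_sub, ← toLin_mul,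
        hcomm.eq, toLin_mul, hsv, toLin_real, smul_sub]
    by_cases hN0 : subOne gu v = 0
    · rw [hN0, add_zero] at hgv
      rw [← smul_coe] at hl hgv
      exact hpv (hp.orthogonal hl (by simp) hgv)
    · obtain ⟨d, hd⟩ := hp.2 _ ⟨hN0, by
        simpa using Phi_subOne_pow 1 1 (by simpa using h2) v v, (s : ℍ[ℝ]),
        by rw [smul_coe, hgN]⟩
      rw [hd] at hgv
      refine h.not_translation hs hε hpp hl ha (d := d) ?_ hpv hgv
      rintro rfl
      simp at hd
      exact hN0 hd

/-! ### The logarithm of a unipotent element -/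

/-- The linear map `(u - u⁻¹) / 2`, which is the logarithm of `u` if `(u - 1)³ = 0`. -/
noncomputable def sinhLog (u : Sp n) : Module.End ℍ[ℝ]ᵐᵒᵖ (V n) :=
  (1 / 2 : ℝ) • (toLin u - toLin u⁻¹)

theorem sinhLog_apply (u : Sp n) (v : V n) :
    sinhLog u v = (1 / 2 : ℝ) • (toLin u v - toLin u⁻¹ v) := rfl

/-- Skew-adjointness is the advantage over `subOne`: it makes the Gram matrix of a Jordan chain
computable without stray factors `u`. -/
theorem Phi_sinhLog (u : Sp n) (v w : V n) : Phi (sinhLog u v) w = -Phi v (sinhLog u w) := by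
  rw [sinhLog_apply, sinhLog_apply, Phi_real_smul_left, Phi_real_smul_right, Phi_sub_left,
    Phi_sub_right, Phi_toLin_left, Phi_toLin_left, inv_inv, ← smul_neg, neg_sub]

theorem sinhLog_real (u : Sp n) (r : ℝ) (v : V n) : sinhLog u (r • v) = r • sinhLog u v := by
  rw [← smul_coe, map_smul, smul_coe]

theorem toLin_sinhLog {u h : Sp n} (hc : Commute h u) (v : V n) :
    toLin h (sinhLog u v) = sinhLog u (toLin h v) := by
  rw [sinhLog_apply, sinhLog_apply, toLin_real, map_sub, ← toLin_mul, ← toLin_mul, ← toLin_mul,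
    ← toLin_mul, hc.eq, hc.inv_right.eq]

theorem toLin_cube_of_subOne {u : Sp n} (h : subOne u ^ 3 = 0) (v : V n) :
    toLin u (toLin u (toLin u v)) - (3 : ℝ) • toLin u (toLin u v) + (3 : ℝ) • toLin u v - v = 0 := by
  have h1 := congrArg (fun f : Module.End ℍ[ℝ]ᵐᵒᵖ (V n) => f v) h
  simp only [pow_succ, pow_zero, one_mul, Module.End.mul_apply, subOne_apply, map_sub,
    LinearMap.zero_apply] at h1
  rw [← h1]
  module

theorem sinhLog_cube {u : Sp n} (h : subOne u ^ 3 = 0) (v : V n) :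
    sinhLog u (sinhLog u (sinhLog u v)) = 0 := by
  have r0 := toLin_cube_of_subOne h v
  have r1 := toLin_cube_of_subOne h (toLin u⁻¹ v)
  have r2 := toLin_cube_of_subOne h (toLin u⁻¹ (toLin u⁻¹ v))
  have r3 := toLin_cube_of_subOne h (toLin u⁻¹ (toLin u⁻¹ (toLin u⁻¹ v)))
  simp only [toLin_apply_inv] at r1 r2 r3
  simp only [sinhLog_apply, map_sub, toLin_real, toLin_apply_inv, toLin_inv_apply]
  -- From `(u - u⁻¹)³ = u⁻³ (u + 1)³ (u - 1)³`, with the coefficients of `(u + 1)³` divided by `8`.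
  linear_combination (norm := module) (1 / 8 : ℝ) • r0 + (3 / 8 : ℝ) • r1 + (3 / 8 : ℝ) • r2 + (1 / 8 : ℝ) • r3

theorem toLin_eq_exp_sinhLog {u : Sp n} (h : subOne u ^ 3 = 0) (v : V n) :
    toLin u v = v + sinhLog u v + (1 / 2 : ℝ) • sinhLog u (sinhLog u v) := by
  have r1 := toLin_cube_of_subOne h (toLin u⁻¹ v)
  have r2 := toLin_cube_of_subOne h (toLin u⁻¹ (toLin u⁻¹ v))
  simp only [toLin_apply_inv] at r1 r2
  simp only [sinhLog_apply, map_sub, toLin_real, toLin_apply_inv, toLin_inv_apply]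
  -- The difference of the two sides is `-(1/8) u⁻² (u - 1)⁴`.
  linear_combination (norm := module) (1 / 8 : ℝ) • r2 - (1 / 8 : ℝ) • r1

theorem sinhLog_sq {u : Sp n} (h : subOne u ^ 3 = 0) (v : V n) :
    sinhLog u (sinhLog u v) = (subOne u ^ 2) v := by
  have r1 := toLin_cube_of_subOne h (toLin u⁻¹ v)
  have r2 := toLin_cube_of_subOne h (toLin u⁻¹ (toLin u⁻¹ v))
  simp only [toLin_apply_inv] at r1 r2
  simp only [sinhLog_apply, map_sub, toLin_real, toLin_apply_inv, toLin_inv_apply, pow_succ,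
    pow_zero, one_mul, Module.End.mul_apply, subOne_apply]
  -- The difference of the two sides is `-(1/4) u⁻² (3 u + 1) (u - 1)³`.
  linear_combination (norm := module) -(3 / 4 : ℝ) • r1 - (1 / 4 : ℝ) • r2

/-! ### Normal form of a Jordan chain and reversal of parabolic elements -/

/-- A three-dimensional Jordan chain for `s g` in normal form. -/
structure IsJordanTriple (g : Sp n) (s a : ℝ) (e₁ e₂ e₃ : V n) : Prop where
  sq : s * s = 1
  pos : 0 < a
  h11 : Phi e₁ e₁ = 0
  h12 : Phi e₁ e₂ = 0
  h13 : Phi e₁ e₃ = -(a : ℍ[ℝ])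
  h22 : Phi e₂ e₂ = (a : ℍ[ℝ])
  h23 : Phi e₂ e₃ = 0
  h33 : Phi e₃ e₃ = 0
  map1 : toLin g e₁ = s • e₁
  map2 : toLin g e₂ = s • (e₂ + e₁)
  map3 : toLin g e₃ = s • (e₃ + e₂ + (1 / 2 : ℝ) • e₁)

theorem exists_jordanTriple {gs gu : Sp n} (hc : Commute gs gu) (h : subOne gu ^ 3 = 0) {v₀ : V n}
    {s : ℝ} (hs : s * s = 1) (hv₀ : toLin gs v₀ = s • v₀) (h2 : (subOne gu ^ 2) v₀ ≠ 0) :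
    ∃ a e₁ e₂ e₃, IsJordanTriple (gs * gu) s a e₁ e₂ e₃ := by
  set X := sinhLog gu with hX
  have hX3 : ∀ v, X (X (X v)) = 0 := sinhLog_cube h
  have g11 : ∀ v, Phi (X (X v)) (X (X v)) = 0 := fun v => by
    rw [Phi_sinhLog, hX3, Phi_zero_right, neg_zero]
  have g21 : ∀ v, Phi (X v) (X (X v)) = 0 := fun v => by
    rw [Phi_sinhLog, hX3, Phi_zero_right, neg_zero]
  have g12 : ∀ v, Phi (X (X v)) (X v) = 0 := fun v => Phi_comm_eq_zero (g21 v)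
  have g13 : ∀ v, Phi (X (X v)) v = -Phi (X v) (X v) := fun v => Phi_sinhLog _ _ _
  obtain ⟨v, hv, hXX, hv2⟩ : ∃ v, toLin gs v = s • v ∧ X (X v) = X (X v₀) ∧ Phi (X v) v = 0 ∧
      Phi v v = 0 := by
    have hne : X (X v₀) ≠ 0 := by rw [hX, sinhLog_sq h]; exact h2
    set r := (Phi (X v₀) (X v₀)).re with hr
    have hrr : Phi (X v₀) (X v₀) = (r : ℍ[ℝ]) := Phi_self _
    -- If `X v₀` were null it would be proportional to the orthogonal null vector `X² v₀`, which `X`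
    -- kills.
    have hr0 : r ≠ 0 := by
      intro h0
      rw [h0, Quaternion.coe_zero] at hrr
      obtain ⟨c, hc⟩ := exists_eq_smul_of_null hne (g11 v₀) hrr (g12 v₀)
      have h1 := congrArg X hc
      rw [map_smul, hX3, smul_zero] at h1
      exact hne h1
    set b := Phi (X v₀) v₀ with hb
    have hbs : star b = -b := by rw [hb, star_Phi, Phi_sinhLog, neg_neg]
    -- Since `b` is imaginary, replacing `v₀` by `v₀ + X v₀ σ` changes `Phi (X v) v` from `b` to `b
    -- + 2 r σ`, which this `σ` makes zero.
    set σ : ℍ[ℝ] := (-1 / (2 * r)) • b with hσ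
    set v₁ := v₀ + X v₀ <• σ with hv₁
    have hX1 : X v₁ = X v₀ + X (X v₀) <• σ := by rw [hv₁, map_add, map_smul]
    have hXX1 : X (X v₁) = X (X v₀) := by rw [hX1, map_add, map_smul, hX3, smul_zero, add_zero]
    have hv₁s : toLin gs v₁ = s • v₁ := by
      rw [hv₁, map_add, toLin_right, toLin_sinhLog hc, hv₀, sinhLog_real, smul_add,
        smul_comm s (MulOpposite.op σ)]
    have h1 : Phi (X v₁) v₁ = 0 := by
      rw [hX1, hv₁]
      simp only [Phi_add_left, Phi_add_right, Phi_smul_left, Phi_smul_right, g12, g13, hrr, ← hb]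
      have hσs : star σ = -σ := by rw [hσ, Quaternion.star_smul, hbs, smul_neg]
      rw [hσs, mul_zero, add_zero, neg_mul_neg, Quaternion.mul_coe_eq_smul,
        Quaternion.coe_mul_eq_smul, hσ, smul_smul, add_assoc, ← add_smul]
      have : r * (-1 / (2 * r)) + r * (-1 / (2 * r)) = -1 := by field_simp; norm_num
      rw [this, neg_one_smul, add_neg_cancel]
    set t := (Phi v₁ v₁).re with ht
    have htt : Phi v₁ v₁ = (t : ℍ[ℝ]) := Phi_self _
    have hr1 : Phi (X (X v₀)) v₁ = -(r : ℍ[ℝ]) := by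
      rw [hv₁, Phi_add_right, Phi_smul_right, g12, g13, hrr, zero_mul, add_zero]
    have hr1' : Phi v₁ (X (X v₀)) = -(r : ℍ[ℝ]) := by
      rw [← star_Phi, hr1, star_neg, Quaternion.star_coe]
    -- `Phi (X² v₀) v₁ = -r`, so this multiple of `X² v₀` lowers the norm of `v₁` by exactly `t` and
    -- leaves `Phi (X v) v = 0`.
    refine ⟨v₁ + (t / (2 * r)) • X (X v₀), ?_, ?_, ?_, ?_⟩
    · rw [map_add, toLin_real, toLin_sinhLog hc, toLin_sinhLog hc, hv₀, hv₁s, sinhLog_real,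
        sinhLog_real, smul_add, smul_comm (t / (2 * r)) s, hv₁, smul_add, smul_add]
    · rw [map_add, map_add, sinhLog_real, hX3, smul_zero, map_zero, add_zero, hXX1]
    · rw [map_add, sinhLog_real, hX3, smul_zero, add_zero, Phi_add_right, h1, Phi_real_smul_right,
        ← hXX1, g21, smul_zero, add_zero]
    · simp only [Phi_add_left, Phi_add_right, Phi_real_smul_left, Phi_real_smul_right, g11, hr1,
        hr1', htt, smul_zero, add_zero]
      rw [← Quaternion.coe_neg, ← Quaternion.coe_smul, ← Quaternion.coe_add, ← Quaternion.coe_add,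
        ← Quaternion.coe_zero]
      congr 1
      rw [smul_eq_mul]
      field_simp
      ring
  have hne : X (X v) ≠ 0 := by rw [hXX, hX, sinhLog_sq h]; exact h2
  have hmap : ∀ w, toLin gs w = s • w → toLin (gs * gu) w =
      s • (w + X w + (1 / 2 : ℝ) • X (X w)) := by
    intro w hw
    rw [hc.eq, toLin_mul, hw, toLin_real, toLin_eq_exp_sinhLog h]
  have hX1s : toLin gs (X v) = s • X v := by rw [toLin_sinhLog hc, hv, sinhLog_real]
  have hX2s : toLin gs (X (X v)) = s • X (X v) := by rw [toLin_sinhLog hc, hX1s, sinhLog_real]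
  set a := (Phi (X v) (X v)).re with ha
  have haa : Phi (X v) (X v) = (a : ℍ[ℝ]) := Phi_self _
  have hapos : 0 < a := by
    refine lt_of_le_of_ne (nonneg_of_orthogonal_null hne (g11 v) (g12 v)) fun h0 => ?_
    rw [← h0, Quaternion.coe_zero] at haa
    obtain ⟨c, hc⟩ := exists_eq_smul_of_null hne (g11 v) haa (g12 v)
    have h1 := congrArg X hc
    rw [map_smul, hX3, smul_zero] at h1
    exact hne h1
  refine ⟨a, X (X v), X v, v, hs, hapos, g11 v, g12 v, by rw [g13, haa], haa, hv2.1, hv2.2, ?_, ?_,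
    hmap v hv⟩
  · rw [hmap _ hX2s, hX3, map_zero, smul_zero, add_zero, add_zero]
  · rw [hmap _ hX1s, hX3, smul_zero, add_zero]

theorem IsJordanTriple.exists_reverses {g : Sp n} {s a : ℝ} {e₁ e₂ e₃ : V n}
    (h : IsJordanTriple g s a e₁ e₂ e₃) (hP : PositiveClassCondition g) :
    ∃ x, Reverses x g := by
  obtain ⟨hs, ha, h11, h12, h13, h22, h23, h33, m1, m2, m3⟩ := h
  have h21 := Phi_comm_eq_zero h12
  have h32 := Phi_comm_eq_zero h23
  have h31 : Phi e₃ e₁ = -(a : ℍ[ℝ]) := by rw [← star_Phi, h13, star_neg, Quaternion.star_coe]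
  have i1 : toLin g⁻¹ e₁ = s • e₁ := by
    have h1 : toLin g (s • e₁) = e₁ := by rw [toLin_real, m1, smul_smul, hs, one_smul]
    rw [← toLin_inv_apply g (s • e₁), h1]
  have i2 : toLin g⁻¹ e₂ = s • (e₂ - e₁) := by
    have h1 : toLin g (s • (e₂ - e₁)) = e₂ := by
      rw [toLin_real, map_sub, m1, m2, ← smul_sub, smul_smul, hs, one_smul, add_sub_cancel_right]
    rw [← toLin_inv_apply g (s • (e₂ - e₁)), h1]
  have i3 : toLin g⁻¹ e₃ = s • (e₃ - e₂ + (1 / 2 : ℝ) • e₁) := by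
    have h1 : toLin g (s • (e₃ - e₂ + (1 / 2 : ℝ) • e₁)) = e₃ := by
      rw [toLin_real, map_add, map_sub, toLin_real, m1, m2, m3, smul_comm (1 / 2 : ℝ) s e₁,
        ← smul_sub, ← smul_add, smul_smul, hs, one_smul]
      module
    rw [← toLin_inv_apply g (s • (e₃ - e₂ + (1 / 2 : ℝ) • e₁)), h1]
  -- On the chain `g = s exp X`; negating only the middle vector changes `X` to `-X`, hence `g` to
  -- `g⁻¹`.
  obtain ⟨R, hR, hRR⟩ := exists_reflection ha.ne' h22
  have hR1 : toLin R e₁ = e₁ := by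
    rw [hR, h21, smul_zero, MulOpposite.op_zero, zero_smul, sub_zero]
  have hR3 : toLin R e₃ = e₃ := by
    rw [hR, h23, smul_zero, MulOpposite.op_zero, zero_smul, sub_zero]
  have hR2 : toLin R e₂ = -e₂ := by
    have h1 : (2 / a : ℝ) • (a : ℍ[ℝ]) = 1 + 1 := by
      rw [← Quaternion.coe_smul, smul_eq_mul, div_mul_cancel₀ _ ha.ne', coe_two]
    rw [hR, h22, h1, MulOpposite.op_add, MulOpposite.op_one, add_smul, one_smul]
    abel
  set W := perp e₁ ⊓ perp e₂ ⊓ perp e₃ with hW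
  have hpos : ∀ w ∈ W, w ≠ 0 → 0 < (Phi w w).re := by
    intro w hw hw0
    refine pos_of_orthogonal_neg (v := e₃ + e₁) ?_ ?_ hw0
    · simp only [Phi_add_left, Phi_add_right, h11, h13, h31, h33]
      simp
      linarith
    · rw [Phi_add_left, mem_perp.mp hw.1.1, mem_perp.mp hw.2, add_zero]
  refine QuatHyp.exists_reverses _ W R rfl hRR hpos (fun w hw => ?_) (fun w hw => ?_)
    (fun v hv => ?_) (fun t ht => hP.even_finrank hpos ht fun v hv => ?_)
  · have w1 := mem_perp.mp hw.1.1
    have w2 := mem_perp.mp hw.1.2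
    have w3 := mem_perp.mp hw.2
    refine ⟨⟨?_, ?_⟩, ?_⟩
    · change Phi e₁ _ = 0
      rw [Phi_toLin_right, i1, Phi_real_smul_left, w1, smul_zero]
    · change Phi e₂ _ = 0
      rw [Phi_toLin_right, i2, Phi_real_smul_left, Phi_sub_left, w1, w2, sub_zero, smul_zero]
    · change Phi e₃ _ = 0
      rw [Phi_toLin_right, i3, Phi_real_smul_left, Phi_add_left, Phi_sub_left, w3, w2,
        Phi_real_smul_left, w1, smul_zero, sub_zero, add_zero, smul_zero]
  · rw [hR, mem_perp.mp hw.1.2, smul_zero, MulOpposite.op_zero, zero_smul, sub_zero]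
  -- The coefficients come from the inverse Gram matrix of the chain and put `u` in `W`; as `v` is
  -- orthogonal to `W`, positivity gives `u = 0`, so `v` lies in the span of the chain.
  · set u := v + a⁻¹ • (e₁ <• Phi e₃ v) - a⁻¹ • (e₂ <• Phi e₂ v) + a⁻¹ • (e₃ <• Phi e₁ v) with hu
    have haa : ∀ q : ℍ[ℝ], a⁻¹ • ((a : ℍ[ℝ]) * q) = q := fun q => by
      rw [Quaternion.coe_mul_eq_smul, smul_smul, inv_mul_cancel₀ ha.ne', one_smul]
    have huW : u ∈ W := by
      refine ⟨⟨?_, ?_⟩, ?_⟩ <;> change Phi _ u = 0 <;>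
      simp only [hu, Phi_add_right, Phi_sub_right, Phi_real_smul_right, Phi_smul_right, h11, h12,
        h13, h21, h22, h23, h31, h32, h33, neg_mul, smul_neg, haa] <;> simp
    have hu0 : u = 0 := by
      by_contra h0
      have h1 := hpos u huW h0
      have h2 : Phi u u = 0 := by
        conv_lhs => rhs; rw [hu]
        simp only [Phi_add_right, Phi_sub_right, Phi_real_smul_right, Phi_smul_right,
          Phi_comm_eq_zero (mem_perp.mp huW.1.1), Phi_comm_eq_zero (mem_perp.mp huW.1.2),
          Phi_comm_eq_zero (mem_perp.mp huW.2), hv u huW]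
        simp
      rw [h2] at h1
      simp at h1
    have hv' : v = -(a⁻¹ • (e₁ <• Phi e₃ v)) + a⁻¹ • (e₂ <• Phi e₂ v) -
        a⁻¹ • (e₃ <• Phi e₁ v) := by
      rw [eq_sub_iff_add_eq, eq_comm, ← sub_eq_iff_eq_add', ← sub_eq_zero, ← neg_eq_zero, ← hu0, hu]
      abel
    have t1 : toLin R (toLin g (toLin R (toLin g e₁))) = e₁ := by
      simp only [m1, toLin_real, hR1, smul_smul, hs, one_smul]
    have t2 : toLin R (toLin g (toLin R (toLin g e₂))) = e₂ := by
      simp only [m1, m2, toLin_real, map_add, map_neg, hR1, hR2, smul_add, smul_neg, smul_smul, hs,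
        one_smul]
      abel
    have t3 : toLin R (toLin g (toLin R (toLin g e₃))) = e₃ := by
      simp only [m1, m2, m3, toLin_real, map_add, map_neg, hR1, hR2, hR3]
      linear_combination (norm := module) hs • e₃
    rw [hv']
    simp only [map_sub, map_add, map_neg, toLin_real, toLin_right, t1, t2, t3]
  -- `g⁻¹` is triangular on the chain, so once the functionals of the earlier vectors vanish the
  -- next one is multiplied by `s`.
  · have k1 := Phi_quadSpace_of_real_eigen ht m1
    have k2 : ∀ v ∈ quadSpace g t 1, Phi e₂ v = 0 :=
      Phi_quadSpace_of_mul (s := s) ht fun v hv => by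
        rw [Phi_toLin_right, i2, Phi_real_smul_left, Phi_sub_left, k1 v hv, sub_zero]
    have k3 : ∀ v ∈ quadSpace g t 1, Phi e₃ v = 0 :=
      Phi_quadSpace_of_mul (s := s) ht fun v hv => by
        rw [Phi_toLin_right, i3, Phi_real_smul_left, Phi_add_left, Phi_sub_left, k2 v hv,
          Phi_real_smul_left, k1 v hv, smul_zero, sub_zero, add_zero]
    exact ⟨⟨k1 v hv, k2 v hv⟩, k3 v hv⟩

theorem IsUniqueNull.exists_reverses {g gs gu : Sp n} {p : V n} (hp : IsUniqueNull g p)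
    (hJ : IsJordanDecomposition g gs gu)
    (hnull : {l | IsNullEigenvalue g l} = {1} ∨ {l | IsNullEigenvalue g l} = {-1})
    (hmin : minimalPolynomial gu = (Polynomial.X - 1) ^ 3) (hP : PositiveClassCondition g) :
    ∃ x, Reverses x g := by
  obtain ⟨s, hs, hl⟩ : ∃ s : ℝ, s * s = 1 ∧ toLin g p = s • p := by
    rcases hnull with h | h
    · refine ⟨1, by norm_num, hp.eigen_of_null ?_⟩
      rw [Quaternion.coe_one]
      exact (h.symm ▸ Set.mem_singleton _ : (1 : ℍ[ℝ]) ∈ {l | IsNullEigenvalue g l})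
    · refine ⟨-1, by norm_num, hp.eigen_of_null ?_⟩
      rw [Quaternion.coe_neg, Quaternion.coe_one]
      exact (h.symm ▸ Set.mem_singleton _ : (-1 : ℍ[ℝ]) ∈ {l | IsNullEigenvalue g l})
  obtain ⟨h3, h2⟩ := (minimalPolynomial_cube_iff gu).mp hmin
  obtain ⟨hup, -, v₀, -, hv₀, hpv⟩ := hp.jordan hJ hs hl
  have hNp : subOne gu p = 0 := by rw [subOne_apply, hup, sub_self]
  obtain ⟨v, hv⟩ : ∃ v, (subOne gu ^ 2) v ≠ 0 := by
    by_contra hcon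
    push Not at hcon
    exact h2 (LinearMap.ext hcon)
  have hsq : ∀ w, (subOne gu ^ 2) w = subOne gu (subOne gu w) := fun w => by
    rw [sq, Module.End.mul_apply]
  have hNv : Phi ((subOne gu ^ 2) v) p = 0 := by
    rw [hsq, Phi_subOne, hNp, Phi_zero_right, neg_zero]
  -- With `N = gu - 1`, the image of `N²` is isotropic and, as `N p = 0`, orthogonal to `p`; it
  -- therefore lies on the line of `p`.
  obtain ⟨c, hc⟩ := exists_eq_smul_of_null hp.1.1 hp.1.2.1
    (Phi_subOne_pow 2 2 (pow_eq_zero_of_le (by norm_num) h3) v v) (Phi_comm_eq_zero hNv)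
  have hc0 : c ≠ 0 := by
    rintro rfl
    rw [hc] at hv
    simp at hv
  -- If `N² v₀ = 0`, moving `N²` across the form would make `v₀` orthogonal to `p`. The chain can
  -- thus start at `v₀`, inside the `s`-eigenspace of `gs`.
  have h2v₀ : (subOne gu ^ 2) v₀ ≠ 0 := by
    intro h0
    have h1 : Phi ((subOne gu ^ 2) v) v₀ = 0 := by
      have hcomm : toLin gu (subOne gu v) = subOne gu (toLin gu v) := by
        simpa using toLin_subOne_pow gu 1 v
      rw [hsq, Phi_subOne, hcomm, Phi_subOne, ← hsq, h0, Phi_zero_right, neg_zero, neg_zero]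
    rw [hc, Phi_smul_left] at h1
    exact (mul_ne_zero (star_ne_zero.mpr hc0) hpv) h1
  obtain ⟨rfl, hcomm, -, -⟩ := hJ
  obtain ⟨a, e₁, e₂, e₃, hT⟩ := exists_jordanTriple hcomm h3 hs hv₀ h2v₀
  exact hT.exists_reverses hP

/-- Valid for unipotent `g` as well, with decomposition `1 * g`; both statements on translations are
special cases. -/
theorem isParabolic_reversible_iff {g gs gu : Sp n} (hg : IsParabolic g)
    (hJ : IsJordanDecomposition g gs gu) :
    StronglyReversible g ↔
      ({l | IsNullEigenvalue g l} = {1} ∨ {l | IsNullEigenvalue g l} = {-1}) ∧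
        minimalPolynomial gu = (Polynomial.X - 1) ^ 3 ∧ PositiveClassCondition g := by
  obtain ⟨p, hp⟩ := hg.exists_unique
  rw [stronglyReversible_iff]
  refine ⟨fun ⟨x, hx⟩ => ?_, fun ⟨h1, h2, h3⟩ => IsUniqueNull.exists_reverses hp hJ h1 h2 h3⟩
  have := IsUniqueNull.of_reverses hp hx hJ
  exact ⟨this.1, this.2, hx.positiveClassCondition⟩

/-! ### Translations -/

theorem isElliptic_one : IsElliptic (1 : Sp n) := by
  refine isElliptic_iff.mpr ⟨Pi.single 0 1, 1, ?_, ?_⟩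
  · simp [Phi]
  · rw [toLin_one, MulOpposite.op_one, one_smul]

theorem IsUnipotent.isJordanDecomposition {u : Sp n} (hu : IsUnipotent u) :
    IsJordanDecomposition u 1 u :=
  ⟨(one_mul u).symm, Commute.one_left u, isElliptic_one, hu⟩

theorem IsVerticalTranslation.not_stronglyReversible {g : Sp n} (hg : IsVerticalTranslation g) :
    ¬StronglyReversible g := by
  obtain ⟨hpar, huni, hmin⟩ := hg
  intro h
  have h1 := ((isParabolic_reversible_iff hpar huni.isJordanDecomposition).mp h).2.1
  rw [hmin] at h1
  have h2 := congrArg Polynomial.natDegree h1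
  rw [Polynomial.natDegree_pow, Polynomial.natDegree_pow, ← Polynomial.C_1,
    Polynomial.natDegree_X_sub_C] at h2
  omega

theorem IsNonVerticalTranslation.stronglyReversible {g : Sp n}
    (hg : IsNonVerticalTranslation g) : StronglyReversible g := by
  obtain ⟨hpar, huni, hmin⟩ := hg
  refine (isParabolic_reversible_iff hpar huni.isJordanDecomposition).mpr ⟨Or.inl ?_, hmin, ?_⟩
  · obtain ⟨p, hp⟩ := hpar.exists_unique
    obtain ⟨hp0, -, l, hl⟩ := hp.1
    obtain rfl := huni.eigenvalue_eq_one hp0 hl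
    exact IsUniqueNull.null_eigenvalues hp hl (star_one _)
  · rintro l ⟨⟨v, hv0, hv⟩, -⟩
    exact Or.inl (huni.eigenvalue_eq_one hv0 hv)

/-! ### Real polynomials in an element and its adjoint -/

/-- Quaternionic matrices as real endomorphisms. -/
noncomputable def realEnd (n : ℕ) : Mat n →ₐ[ℝ] Module.End ℝ (V n) where
  toFun A :=
    { toFun := fun v => A *ᵥ v
      map_add' := fun v w => Matrix.mulVec_add A v w
      map_smul' := fun r v => Matrix.mulVec_smul A r v }
  map_one' := LinearMap.ext fun v => Matrix.one_mulVec v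
  map_mul' A B := LinearMap.ext fun v => (Matrix.mulVec_mulVec v A B).symm
  map_zero' := LinearMap.ext fun v => Matrix.zero_mulVec v
  map_add' A B := LinearMap.ext fun v => Matrix.add_mulVec A B v
  commutes' r := LinearMap.ext fun v => by
    change algebraMap ℝ (Mat n) r *ᵥ v = r • v
    rw [Algebra.algebraMap_eq_smul_one, Matrix.smul_mulVec, Matrix.one_mulVec]

theorem realEnd_injective : Function.Injective (realEnd n) := fun _ _ h =>
  mulVec_ext fun v => congrArg (fun f : Module.End ℝ (V n) => f v) h

/-- `B` is the adjoint of `A` with respect to the form. -/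
def IsAdjoint (A B : Mat n) : Prop := ∀ v w : V n, Phi (A *ᵥ v) w = Phi v (B *ᵥ w)

theorem IsAdjoint.symm {A B : Mat n} (h : IsAdjoint A B) : IsAdjoint B A := fun v w => by
  rw [← star_Phi, ← h, star_Phi]

theorem IsAdjoint.add {A B A' B' : Mat n} (h : IsAdjoint A B) (h' : IsAdjoint A' B') :
    IsAdjoint (A + A') (B + B') := fun v w => by
  rw [Matrix.add_mulVec, Matrix.add_mulVec, Phi_add_left, Phi_add_right, h, h']

theorem IsAdjoint.mul {A B A' B' : Mat n} (h : IsAdjoint A B) (h' : IsAdjoint A' B') :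
    IsAdjoint (A * A') (B' * B) := fun v w => by
  rw [← Matrix.mulVec_mulVec, ← Matrix.mulVec_mulVec, h, h']

theorem IsAdjoint.aeval {A B : Mat n} (h : IsAdjoint A B) (P : Polynomial ℝ) :
    IsAdjoint (Polynomial.aeval A P) (Polynomial.aeval B P) := by
  have hC : ∀ r : ℝ, IsAdjoint (algebraMap ℝ (Mat n) r) (algebraMap ℝ (Mat n) r) := fun r v w => by
    rw [Algebra.algebraMap_eq_smul_one, Matrix.smul_mulVec, Matrix.smul_mulVec, Matrix.one_mulVec,
      Matrix.one_mulVec, Phi_real_smul_left, Phi_real_smul_right]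
  induction P using Polynomial.induction_on with
  | C r => simpa using hC r
  | add p q hp hq => simpa using hp.add hq
  | monomial k r hk =>
    have h1 := hk.mul h
    rw [pow_succ, ← mul_assoc, map_mul (Polynomial.aeval A) _ Polynomial.X,
      map_mul (Polynomial.aeval B) _ Polynomial.X, Polynomial.aeval_X, Polynomial.aeval_X]
    have h2 : B * Polynomial.aeval B (Polynomial.C r * Polynomial.X ^ k) =
        Polynomial.aeval B (Polynomial.C r * Polynomial.X ^ k) * B := by
      conv_lhs => lhs; rw [← Polynomial.aeval_X (R := ℝ) B]
      conv_rhs => rhs; rw [← Polynomial.aeval_X (R := ℝ) B]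
      rw [← map_mul, ← map_mul, mul_comm]
    rwa [h2] at h1

theorem IsAdjoint.eq_zero {A B : Mat n} (h : IsAdjoint A B) (hA : A = 0) : B = 0 :=
  mulVec_ext fun w => by
    rw [Matrix.zero_mulVec]
    refine eq_zero_of_Phi_eq_zero fun v => ?_
    rw [← star_Phi, ← h, hA, Matrix.zero_mulVec, Phi_zero_left, star_zero]

theorem isAdjoint_mat (g : Sp n) : IsAdjoint (mat g) (mat g⁻¹) := Phi_toLin_left g

theorem aeval_mulVec_eigen {A : Mat n} {p : V n} {r : ℝ} (h : A *ᵥ p = r • p)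
    (P : Polynomial ℝ) : Polynomial.aeval A P *ᵥ p = P.eval r • p := by
  induction P using Polynomial.induction_on with
  | C c =>
    rw [Polynomial.aeval_C, Algebra.algebraMap_eq_smul_one, Matrix.smul_mulVec, Matrix.one_mulVec,
      Polynomial.eval_C]
  | add p q hp hq => rw [map_add, Matrix.add_mulVec, hp, hq, Polynomial.eval_add, add_smul]
  | monomial k c hk =>
    rw [pow_succ, ← mul_assoc, map_mul, Polynomial.aeval_X, ← Matrix.mulVec_mulVec, h,
      Matrix.mulVec_smul, hk, Polynomial.eval_mul_X, smul_smul, mul_comm]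

theorem aeval_realEnd_eq_zero {A : Mat n} {F : Polynomial ℝ}
    (h : Polynomial.aeval (realEnd n A) F = 0) : Polynomial.aeval A F = 0 := by
  rw [Polynomial.aeval_algHom_apply] at h
  exact realEnd_injective (h.trans (map_zero _).symm)

/-- The adjoint is annihilated by the same squarefree real polynomial. -/
theorem IsAdjoint.isSemisimple {A B : Mat n} (h : IsAdjoint A B)
    (hA : (realEnd n A).IsSemisimple) : (realEnd n B).IsSemisimple := by
  refine Module.End.isSemisimple_of_squarefree_aeval_eq_zero hA.minpoly_squarefree ?_
  rw [Polynomial.aeval_algHom_apply,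
    (h.aeval _).eq_zero (aeval_realEnd_eq_zero (minpoly.aeval ℝ (realEnd n A))), map_zero]

/-- For semisimple `A`, the `r`-eigenspaces of `A` and of its adjoint are in duality. -/
theorem IsAdjoint.exists_eigen {A B : Mat n} (h : IsAdjoint A B)
    (hA : (realEnd n A).IsSemisimple) {p : V n} (hp : p ≠ 0) {r : ℝ} (hB : B *ᵥ p = r • p) :
    ∃ w, A *ᵥ w = r • w ∧ Phi p w ≠ 0 := by
  set F := minpoly ℝ (realEnd n A) with hF
  have hF0 : Polynomial.aeval A F = 0 := aeval_realEnd_eq_zero (minpoly.aeval ℝ (realEnd n A))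
  have hroot : F.IsRoot r := by
    have h1 := aeval_mulVec_eigen hB F
    rw [(h.aeval F).eq_zero hF0, Matrix.zero_mulVec] at h1
    exact (smul_eq_zero.mp h1.symm).resolve_right hp
  obtain ⟨R, hR⟩ := Polynomial.dvd_iff_isRoot.mpr hroot
  have hRr : R.eval r ≠ 0 := by
    intro h0
    obtain ⟨R', hR'⟩ := Polynomial.dvd_iff_isRoot.mpr h0
    have h1 := hA.minpoly_squarefree (Polynomial.X - Polynomial.C r)
      ⟨R', by rw [← hF, hR, hR', mul_assoc]⟩
    exact Polynomial.not_isUnit_X_sub_C r h1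
  obtain ⟨v, hv⟩ := exists_Phi_ne_zero hp
  -- Squarefreeness gives `F = (X - r) R` with `R(r) ≠ 0`: `R(A)` maps into the `r`-eigenspace, and
  -- its adjoint `R(B)` scales `p` by `R(r)`.
  refine ⟨Polynomial.aeval A R *ᵥ v, ?_, ?_⟩
  · rw [hR, map_mul] at hF0
    have h1 := congrArg (fun C : Mat n => C *ᵥ v) hF0
    simp only [← Matrix.mulVec_mulVec, map_sub, Polynomial.aeval_X, Polynomial.aeval_C,
      Matrix.sub_mulVec, Matrix.zero_mulVec, Algebra.algebraMap_eq_smul_one, Matrix.smul_mulVec,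
      Matrix.one_mulVec] at h1
    exact sub_eq_zero.mp h1
  · rw [← (h.symm.aeval R) p v, aeval_mulVec_eigen hB, Phi_real_smul_left]
    exact smul_ne_zero hRr hv

theorem commute_aeval {A B : Mat n} (h : Commute A B) (P Q : Polynomial ℝ) :
    Commute (Polynomial.aeval A P) (Polynomial.aeval B Q) := by
  have key : ∀ {C D : Mat n}, Commute C D → ∀ P : Polynomial ℝ,
      Commute (Polynomial.aeval C P) D := fun {C D} hCD P =>
    Algebra.commute_of_mem_adjoin_singleton_of_commute
      (Polynomial.aeval_mem_adjoin_singleton ℝ C) hCD.symm |>.symm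
  exact key (key h.symm Q).symm P

/-! ### The Jordan decomposition -/

/-- The Jordan decomposition in `Sp(n,1)`, with a semisimple first component. -/
theorem exists_semisimple_unipotent (g : Sp n) :
    ∃ gs gu : Sp n, g = gs * gu ∧ Commute gs gu ∧ (realEnd n (mat gs)).IsSemisimple ∧
      IsUnipotent gu := by
  obtain ⟨N₀, hN₀, S₀, hS₀, hnil, hss, hsum⟩ :=
    (realEnd n (mat g)).exists_isNilpotent_isSemisimple
  rw [Algebra.adjoin_singleton_eq_range_aeval] at hN₀ hS₀
  obtain ⟨Q, rfl⟩ := hN₀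
  obtain ⟨P, rfl⟩ := hS₀
  simp only [AlgHom.toRingHom_eq_coe, RingHom.coe_coe, Polynomial.aeval_algHom_apply]
    at hnil hss hsum
  set M := mat g with hM
  set M' := mat g⁻¹ with hM'
  have hMM' : M * M' = 1 := (g : (Mat n)ˣ).mul_inv
  have hM'M : M' * M = 1 := (g : (Mat n)ˣ).inv_mul
  have hc : Commute M M' := hMM'.trans hM'M.symm
  have hadj : IsAdjoint M M' := isAdjoint_mat g
  set S := Polynomial.aeval M P with hS
  set N := Polynomial.aeval M Q with hN
  set S' := Polynomial.aeval M' P with hS'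
  set N' := Polynomial.aeval M' Q with hN'
  have hSS' : IsAdjoint S S' := hadj.aeval P
  have hMsum : M = N + S := realEnd_injective (by rw [map_add]; exact hsum)
  -- The relation `M = Q(M) + P(M)` is a real polynomial identity, so it passes to the adjoint `M' =
  -- M⁻¹`.
  have hM'sum : M' = N' + S' := by
    have h1 : Polynomial.aeval M (Polynomial.X - (Q + P)) = 0 := by
      rw [map_sub, map_add, Polynomial.aeval_X, ← hMsum, sub_self]
    have h2 := (hadj.aeval _).eq_zero h1
    rw [map_sub, map_add, Polynomial.aeval_X] at h2
    exact sub_eq_zero.mp h2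
  have hNnil : IsNilpotent N := by
    obtain ⟨k, hk⟩ := hnil
    exact ⟨k, realEnd_injective (by rw [map_pow, hk, map_zero])⟩
  have hN'nil : IsNilpotent N' := by
    obtain ⟨k, hk⟩ := hNnil
    refine ⟨k, ?_⟩
    rw [hN', ← map_pow]
    exact (hadj.aeval _).eq_zero (by rw [map_pow]; exact hk)
  have cX : ∀ C : Mat n, C = Polynomial.aeval C (Polynomial.X : Polynomial ℝ) := fun C =>
    (Polynomial.aeval_X C).symm
  have cSS' : Commute S S' := commute_aeval hc P P
  have cNM' : Commute N M' := by rw [cX M']; exact commute_aeval hc Q _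
  have cSN' : Commute S N' := commute_aeval hc P Q
  have cNS : Commute N S := commute_aeval (Commute.refl M) Q P
  have cNN' : Commute N N' := commute_aeval hc Q Q
  have cM'S : Commute M' S := by rw [cX M']; exact commute_aeval hc.symm _ P
  have cM'N' : Commute M' N' := by
    conv => lhs; rw [cX M']
    exact commute_aeval (Commute.refl M') _ Q
  -- Expanding `M M' = 1` shows that `S S' - 1` is nilpotent; it is also semisimple, hence zero.
  -- This says that `S` preserves the form.
  have hone : S * S' = 1 := by
    have h1 : S * S' - 1 = -(N * M' + S * N') := by
      rw [← hMM', hMsum, hM'sum]; noncomm_ring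
    have hnil1 : IsNilpotent (S * S' - 1) := by
      rw [h1]
      refine IsNilpotent.neg (Commute.isNilpotent_add ?_ (cNM'.isNilpotent_mul_right hNnil)
        (cSN'.isNilpotent_mul_left hN'nil))
      exact (cNS.mul_right cNN').mul_left (cM'S.mul_right cM'N')
    have hss' := hSS'.isSemisimple hss
    have hss1 : (realEnd n (S * S' - 1)).IsSemisimple := by
      rw [map_sub, map_mul, map_one]
      exact (hss.mul_of_commute (cSS'.map (realEnd n)) hss').sub_of_commute
        (Commute.one_right _) Module.End.isSemisimple_id
    have h2 := Module.End.eq_zero_of_isNilpotent_isSemisimple (hnil1.map (realEnd n)) hss1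
    exact sub_eq_zero.mp (realEnd_injective (h2.trans (map_zero _).symm))
  have hone' : S' * S = 1 := by rw [← cSS'.eq, hone]
  obtain ⟨gs, hgs⟩ := exists_toLin_eq hone hone' fun v w => by
    rw [hSS', Matrix.mulVec_mulVec, hone', Matrix.one_mulVec]
  have hcomm : Commute gs g := by
    refine Subtype.ext (Units.ext ?_)
    change mat gs * M = M * mat gs
    rw [hgs, cX M]
    exact (commute_aeval (Commute.refl M) P _).eq
  refine ⟨gs, gs⁻¹ * g, (mul_inv_cancel_left gs g).symm, ?_, by rw [hgs]; exact hss, ?_⟩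
  · exact (Commute.refl gs).inv_right.mul_right hcomm
  · have hinv : mat gs⁻¹ = S' := by
      have h1 : mat gs⁻¹ * mat gs = 1 := (gs : (Mat n)ˣ).inv_mul
      calc mat gs⁻¹ = mat gs⁻¹ * (S * S') := by rw [hone, mul_one]
        _ = S' := by rw [← mul_assoc, ← hgs, h1, one_mul]
    have h2 : mat (gs⁻¹ * g) - 1 = S' * N := by
      change mat gs⁻¹ * M - 1 = _
      rw [hinv, hMsum, mul_add, hone', add_sub_cancel_right]
    rw [IsUnipotent, h2]
    exact (commute_aeval hc.symm P Q).isNilpotent_mul_left hNnil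

/-! ### Ellipticity of the semisimple component of a parabolic element -/

/-- The real quadratic polynomial of `l` at `g⁻¹` has image orthogonal to `p`, so it is not
injective and `g⁻¹` has an eigenvector `e` for `l`. If `|l| ≠ 1`, then `e` is null, hence a multiple
of `p`; so `l` is similar to `l⁻¹` and `|l| = 1` after all. -/
theorem IsUniqueNull.norm_eigenvalue {g : Sp n} {p : V n} (hp : IsUniqueNull g p) {l : ℍ[ℝ]}
    (hl : toLin g p = p <• l) : ‖l‖ = 1 := by
  have hp0 := hp.1.1
  let A' : Module.End ℍ[ℝ]ᵐᵒᵖ (V n) :=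
    toLin g⁻¹ * toLin g⁻¹ - (2 * l.re) • toLin g⁻¹ + l.normSq • 1
  have hA' : ∀ v, A' v =
      toLin g⁻¹ (toLin g⁻¹ v) - (2 * l.re) • toLin g⁻¹ v + l.normSq • v := fun v => rfl
  have horth : ∀ v, Phi p (A' v) = 0 := by
    intro v
    have h1 := mem_quadSpace.mp (mem_quadSpace_of_eigen hl)
    have h2 : Phi (toLin g (toLin g p) - (2 * l.re) • toLin g p + l.normSq • p) v = 0 := by
      rw [h1, sub_sub_cancel_left, neg_add_cancel, Phi_zero_left]
    rw [hA', Phi_add_right, Phi_sub_right, Phi_real_smul_right, Phi_real_smul_right,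
      Phi_toLin_right, Phi_toLin_right, Phi_toLin_right, inv_inv, ← h2, Phi_add_left, Phi_sub_left,
      Phi_real_smul_left, Phi_real_smul_left]
  have hninj : ¬Function.Injective A' := by
    intro hinj
    obtain ⟨w, hw⟩ := exists_Phi_ne_zero hp0
    obtain ⟨v, rfl⟩ := (LinearMap.injective_iff_surjective.mp hinj) w
    exact hw (horth v)
  obtain ⟨w, hw, hw0⟩ : ∃ w, A' w = 0 ∧ w ≠ 0 := by
    by_contra hcon
    push Not at hcon
    exact hninj ((injective_iff_map_eq_zero A').mpr hcon)
  have hwq : w ∈ quadSpace g⁻¹ l.re l.normSq := by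
    rw [mem_quadSpace, ← sub_eq_zero, ← hw, hA']; abel
  obtain ⟨e, -, he0, he⟩ := exists_eigen_of_mem_quadSpace hw0 hwq
    (fun u hu => toLin_mem_quadSpace hu) hwq
  by_contra hne
  have hee : Phi e e = 0 := Phi_self_eq_zero (by
    by_contra h0
    exact hne (QuatHyp.norm_eigenvalue he h0))
  have heg := toLin_inv_eigen he
  rw [inv_inv] at heg
  obtain ⟨c, rfl⟩ := hp.2 e ⟨he0, hee, _, heg⟩
  have hc : c ≠ 0 := by rintro rfl; simp at he0
  rw [toLin_right, hl, ← smul_right_mul, ← smul_right_mul] at heg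
  have h1 := congrArg norm (smul_right_inj hp0 heg)
  rw [norm_mul, norm_mul, norm_inv, mul_comm] at h1
  have h2 : ‖l‖ = ‖l‖⁻¹ := mul_left_cancel₀ (norm_ne_zero_iff.mpr hc) h1
  have h3 : ‖l‖ ≠ 0 := norm_ne_zero_iff.mpr (eigenvalue_ne_zero hp0 hl)
  have h4 : ‖l‖ * ‖l‖ = 1 := by
    nth_rewrite 2 [h2]
    exact mul_inv_cancel₀ h3
  exact hne (by nlinarith [norm_nonneg l])

/-- A semisimple element fixing a boundary point with an eigenvalue of norm one is elliptic. -/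
theorem isElliptic_of_semisimple {g : Sp n} (hss : (realEnd n (mat g)).IsSemisimple) {p : V n}
    (hp0 : p ≠ 0) (hpp : Phi p p = 0) {l : ℍ[ℝ]} (hl : toLin g p = p <• l) (hn : ‖l‖ = 1) :
    IsElliptic g := by
  have hinv := toLin_inv_eigen hl
  rw [inv_eq_star_of_norm hn] at hinv
  -- Semisimplicity supplies an eigenvector for `l` not orthogonal to `p`: by duality between `g`
  -- and `g⁻¹` for real `l`, and through the self-adjoint `g + g⁻¹` otherwise.
  obtain ⟨w, hw, hpw⟩ : ∃ w, toLin g w = w <• l ∧ Phi p w ≠ 0 := by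
    by_cases hs : star l = l
    · rw [hs, eq_coe_of_star_eq hs, smul_coe] at hinv
      obtain ⟨w, hw, hpw⟩ := (isAdjoint_mat g).exists_eigen hss hp0 hinv
      refine ⟨w, ?_, hpw⟩
      rw [eq_coe_of_star_eq hs, smul_coe]
      exact hw
    · have hadj := isAdjoint_mat g
      have hcomm : Commute (mat g) (mat g⁻¹) :=
        ((g : (Mat n)ˣ).mul_inv).trans ((g : (Mat n)ˣ).inv_mul).symm
      have hss' : (realEnd n (mat g + mat g⁻¹)).IsSemisimple := by
        rw [map_add]
        exact hss.add_of_commute (hcomm.map (realEnd n)) (hadj.isSemisimple hss)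
      have hself : IsAdjoint (mat g + mat g⁻¹) (mat g + mat g⁻¹) := by
        have := hadj.add hadj.symm
        rwa [add_comm (mat g⁻¹)] at this
      have hBp : (mat g + mat g⁻¹) *ᵥ p = (2 * l.re) • p := by
        rw [Matrix.add_mulVec]
        change toLin g p + toLin g⁻¹ p = _
        rw [hl, hinv, ← add_smul, ← MulOpposite.op_add, add_star_eq, smul_coe]
      obtain ⟨w, hw, hpw⟩ := hself.exists_eigen hss' hp0 hBp
      rw [Matrix.add_mulVec] at hw
      have hwq : w ∈ quadSpace g l.re l.normSq := by
        rw [normSq_eq_one hn, mem_quadSpace_one]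
        exact hw
      obtain ⟨a, b, c, d, ha, hb, rfl⟩ := exists_decomp_of_mem_quadSpace hs hwq
      by_cases hpa : Phi p a = 0
      · refine ⟨b, hb, fun hpb => hpw ?_⟩
        rw [Phi_add_right, Phi_smul_right, Phi_smul_right, hpa, hpb, zero_mul, zero_mul, add_zero]
      · exact ⟨a, ha, hpa⟩
  have hcl : l * Phi p w = Phi p w * l := by
    have h1 := Phi_eigen hl hw
    calc l * Phi p w = l * (star l * Phi p w * l) := by rw [h1]
      _ = Phi p w * l := by
        rw [mul_assoc, ← mul_assoc l, mul_star_self_of_norm hn, one_mul]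
  have hd : 0 < (Phi p w).normSq :=
    lt_of_le_of_ne Quaternion.normSq_nonneg (Quaternion.normSq_ne_zero.mpr hpw).symm
  -- This `T` brings the norm of `w` below zero; since `Phi p w` commutes with `l`, the modified
  -- vector is still an eigenvector for `l`.
  set T : ℝ := -(1 + |(Phi w w).re|) / (2 * (Phi p w).normSq) with hT
  refine isElliptic_iff.mpr ⟨w + p <• (T • Phi p w), l, ?_, ?_⟩
  · rw [re_Phi_add_null hpp]
    have h1 : 2 * T * (Phi p w).normSq = -(1 + |(Phi w w).re|) := by
      rw [hT]; field_simp
    rw [h1]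
    linarith [le_abs_self (Phi w w).re]
  · have hc : l * (T • Phi p w) = (T • Phi p w) * l := by
      rw [mul_smul_comm, smul_mul_assoc, hcl]
    rw [map_add, hw, toLin_eigen_smul hl _ hc, smul_add]

/-- The unipotent component fixes `p`, so the semisimple one has at `p` the eigenvalue of `g`, which
has norm one. -/
theorem IsParabolic.exists_jordanDecomposition {g : Sp n} (hg : IsParabolic g) :
    ∃ gs gu : Sp n, IsJordanDecomposition g gs gu := by
  obtain ⟨p, hp⟩ := hg.exists_unique
  have hp : IsUniqueNull g p := hp
  obtain ⟨gs, gu, hg, hc, hss, hu⟩ := exists_semisimple_unipotent g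
  refine ⟨gs, gu, hg, hc, ?_, hu⟩
  obtain ⟨hp0, hpp, l, hl⟩ := hp.1
  have hcu : Commute gu g := by rw [hg]; exact hc.symm.mul_right (Commute.refl gu)
  obtain ⟨b, hb⟩ := hp.commute hcu
  rw [hu.eigenvalue_eq_one hp0 hb, MulOpposite.op_one, one_smul] at hb
  have hls : toLin gs p = p <• l := by rw [← hl, hg, toLin_mul, hb]
  exact isElliptic_of_semisimple hss hp0 hpp hls (hp.norm_eigenvalue hl)

end QuatHyp


theorem theorem1p4 (n : ℕ) (g : QuatHyp.Sp n) :
    -- hyperbolic elements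
    (QuatHyp.IsHyperbolic g →
      (QuatHyp.StronglyReversible g ↔
        QuatHyp.PositiveClassCondition g ∧
          ∀ lam, QuatHyp.IsNullEigenvalue g lam → ∃ r : ℝ, lam = (r : ℍ[ℝ]))) ∧
    -- elliptic elements
    (QuatHyp.IsElliptic g →
      (QuatHyp.StronglyReversible g ↔
        ({lam | QuatHyp.IsNegativeType g lam ∨ QuatHyp.IsIndefiniteType g lam} = {1} ∨
          {lam | QuatHyp.IsNegativeType g lam ∨ QuatHyp.IsIndefiniteType g lam} = {-1}) ∧
        QuatHyp.PositiveClassCondition g)) ∧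
    -- vertical translations
    (QuatHyp.IsVerticalTranslation g → ¬ QuatHyp.StronglyReversible g) ∧
    -- non-vertical translations
    (QuatHyp.IsNonVerticalTranslation g → QuatHyp.StronglyReversible g) ∧
    -- non-unipotent parabolic elements
    (QuatHyp.IsParabolic g → ¬ QuatHyp.IsUnipotent g →
      (∃ gs gu : QuatHyp.Sp n, QuatHyp.IsJordanDecomposition g gs gu) ∧
      ∀ gs gu : QuatHyp.Sp n, QuatHyp.IsJordanDecomposition g gs gu →
        (QuatHyp.StronglyReversible g ↔
          ({lam | QuatHyp.IsNullEigenvalue g lam} = {1} ∨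
            {lam | QuatHyp.IsNullEigenvalue g lam} = {-1}) ∧
          QuatHyp.minimalPolynomial gu = (Polynomial.X - 1) ^ 3 ∧
          QuatHyp.PositiveClassCondition g)) :=
  ⟨QuatHyp.isHyperbolic_reversible_iff, QuatHyp.isElliptic_reversible_iff,
    QuatHyp.IsVerticalTranslation.not_stronglyReversible,
    QuatHyp.IsNonVerticalTranslation.stronglyReversible,
    fun hg _ => ⟨hg.exists_jordanDecomposition,
      fun _ _ hJ => QuatHyp.isParabolic_reversible_iff hg hJ⟩⟩
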